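/- Let $\kappa\in\mathbb R$, and set $\varpi_\kappa=\pi/\sqrt\kappa$ if $\kappa>0$ and $\varpi_\kappa=\infty$ if $\kappa\le 0$. For points $p,q,r$ of a metric space with $p\ne q$, $p\ne r$ and perimeter $|pq|+|qr|+|rp|<2\varpi_\kappa$, let the model angle $\tilde\measuredangle^\kappa(p;q,r)$ be the angle at $\tilde p$ of a triangle $\tilde p\tilde q\tilde r$ with the same side lengths in the complete simply connected surface of constant curvature $\kappa$; otherwise the model angle is undefined. A quadruple $p^1,p^2,x^1,x^2$ satisfies $\mathrm{CAT}(\kappa)$ comparison if $$\tilde\measuredangle^\kappa(p^1;x^1,x^2)\le\tilde\measuredangle^\kappa(p^1;p^2,x^1)+\tilde\measuredangle^\kappa(p^1;p^2,x^2),$$ or $$\tilde\measuredangle^\kappa(p^2;x^1,x^2)\le\tilde\measuredangle^\kappa(p^2;p^1,x^1)+\tilde\measuredangle^\kappa(p^2;p^1,x^2),$$ or one of these six model angles is undefined. A metric space is $\mathrm{CAT}(\kappa)$ if all its quadruples satisfy $\mathrm{CAT}(\kappa)$ comparison, and locally $\mathrm{CAT}(\kappa)$ if every point has a neighborhood all of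 whose quadruples satisfy it. A metric space is a length space if the distance between any two points is the infimum of the lengths of the paths joining them. A geodesic path from $x$ to $y$ is a map $\gamma:[0,1]\to U$ with $\gamma(0)=x$, $\gamma(1)=y$ and $|\gamma(s)\gamma(t)|=|s-t|\cdot|xy|$ for all $s,t\in[0,1]$. Theorem. For a complete length space $U$ (with finite distances), the following two statements are equivalent: (a) $U$ is $\mathrm{CAT}(\kappa)$. (b) $U$ is locally $\mathrm{CAT}(\kappa)$; moreover, any two points $x,y\in U$ with $|xy|<\varpi_\kappa$ are joined by a unique geodesic path, and these geodesic paths depend continuously on their endpoint pairs, that is, $(x,y)\mapsto\gamma_{xy}$ is a continuous map from $\{(x,y)\in U\times U: |xy|<\varpi_\kappa\}$ to the space of paths $[0,1]\to U$ with the topology of uniform convergence. -/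

import Mathlib

open scoped ENNReal Topology

noncomputable section

/-- The diameter `ϖκ` of the model `κ`-plane: `π / √κ` if `κ > 0`, and `∞` if `κ ≤ 0`. -/
def varpi (κ : ℝ) : ℝ≥0∞ :=
  if 0 < κ then ENNReal.ofReal (Real.pi / Real.sqrt κ) else ⊤

/-- The points of the model `κ`-plane, the complete simply connected surface of constant
curvature `κ`, as a quadric surface in `ℝ³` with Riemannian metric induced by the form
`du₀² / κ + du₁² + du₂²` (the first term is absent if `κ = 0`):
for `κ > 0` the linear change `u₀ = √κ * h` turns it into the round sphere of radius `1 / √κ`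
in Euclidean space, for `κ = 0` it is the Euclidean plane `{1} × ℝ²`, and for `κ < 0` the
change `u₀ = √(-κ) * h` turns it into the upper sheet of the hyperboloid
`-h² + u₁² + u₂² = 1 / κ` in Minkowski space, that is, the Lobachevsky plane of curvature `κ`. -/
@[ext]
structure ModelPlane (κ : ℝ) where
  u₀ : ℝ
  u₁ : ℝ
  u₂ : ℝ
  mem_quadric : u₀ ^ 2 + κ * (u₁ ^ 2 + u₂ ^ 2) = 1
  upper_sheet : κ ≤ 0 → 0 < u₀

namespace ModelPlane

variable {κ : ℝ}

/-- The (normalised) bilinear product of two points. For `κ > 0` it is the cosine of the angle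
between the corresponding rays. -/
def prod (x y : ModelPlane κ) : ℝ :=
  x.u₀ * y.u₀ + κ * (x.u₁ * y.u₁ + x.u₂ * y.u₂)

/-- The distance of the model plane: spherical, Euclidean or hyperbolic. -/
def distance (x y : ModelPlane κ) : ℝ :=
  if 0 < κ then Real.arccos (prod x y) / Real.sqrt κ
  else if κ = 0 then Real.sqrt ((x.u₁ - y.u₁) ^ 2 + (x.u₂ - y.u₂) ^ 2)
  else Real.arcosh (prod x y) / Real.sqrt (-κ)

/-- The components of a vector tangent to the model plane at `p` that points in the initial
direction of the shortest path from `p` to `x` (it is `x - p` for `κ = 0`). -/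
def direction (p x : ModelPlane κ) : ℝ × ℝ × ℝ :=
  (x.u₀ - prod p x * p.u₀, x.u₁ - prod p x * p.u₁, x.u₂ - prod p x * p.u₂)

/-- The Riemannian scalar product of tangent vectors. For `κ = 0` tangent vectors have zero first
component, and the first term is zero by the convention on division by zero. -/
def tangentInner (κ : ℝ) (v w : ℝ × ℝ × ℝ) : ℝ :=
  v.1 * w.1 / κ + v.2.1 * w.2.1 + v.2.2 * w.2.2

/-- The angle at the vertex `p` of the triangle with vertices `p`, `x`, `y`. -/
def angle (p x y : ModelPlane κ) : ℝ :=
  Real.arccos (tangentInner κ (direction p x) (direction p y) /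
    Real.sqrt (tangentInner κ (direction p x) (direction p x) *
      tangentInner κ (direction p y) (direction p y)))

end ModelPlane

/-- `(p, x, y)` is a triangle in the model `κ`-plane with side lengths `a = |xy|`, `b = |py|`,
`c = |px|`. -/
def IsModelTriangle (κ a b c : ℝ) (p x y : ModelPlane κ) : Prop :=
  x.distance y = a ∧ p.distance y = b ∧ p.distance x = c

open Classical in
/-- The model angle `∡̃κ{a; b, c}`: the angle opposite to the side of length `a` in a triangle of
the model `κ`-plane with side lengths `a`, `b`, `c`. It is used only if `b, c > 0` and
`a, b, c` satisfy the triangle inequalities and `a + b + c < 2 ϖκ`; then such a triangle exists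
(`exists_isModelTriangle`), and all such triangles have the same angle
(`modelAngle_eq_angle`). -/
def modelAngle (κ a b c : ℝ) : ℝ :=
  if h : ∃ T : ModelPlane κ × ModelPlane κ × ModelPlane κ,
      IsModelTriangle κ a b c T.1 T.2.1 T.2.2 then
    ModelPlane.angle h.choose.1 h.choose.2.1 h.choose.2.2
  else 0

/-- The cosine of the model plane: the solution of `x'' + κ x = 0`, `x 0 = 1`, `x' 0 = 0`. -/
def modelCos (κ t : ℝ) : ℝ :=
  if 0 < κ then Real.cos (Real.sqrt κ * t)
  else if κ = 0 then 1
  else Real.cosh (Real.sqrt (-κ) * t)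

/-- The sine of the model plane: the solution of `y'' + κ y = 0`, `y 0 = 0`, `y' 0 = 1`. -/
def modelSin (κ t : ℝ) : ℝ :=
  if 0 < κ then Real.sin (Real.sqrt κ * t) / Real.sqrt κ
  else if κ = 0 then t
  else Real.sinh (Real.sqrt (-κ) * t) / Real.sqrt (-κ)

/-- The right-hand side of the law of cosines of the model `κ`-plane. -/
def cosineLaw (κ a b c : ℝ) : ℝ :=
  if κ = 0 then (b ^ 2 + c ^ 2 - a ^ 2) / (2 * b * c)
  else (modelCos κ a - modelCos κ b * modelCos κ c) / (κ * modelSin κ b * modelSin κ c)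

theorem modelCos_sq_add (κ t : ℝ) : modelCos κ t ^ 2 + κ * modelSin κ t ^ 2 = 1 := by
  unfold modelCos modelSin
  split_ifs with h1 h2
  · have := Real.sq_sqrt h1.le
    have h3 : Real.sqrt κ ≠ 0 := (Real.sqrt_pos.2 h1).ne'
    rw [div_pow, this]
    field_simp
    exact Real.cos_sq_add_sin_sq _
  · simp [h2]
  · have h3 : 0 < -κ := by
      rcases lt_trichotomy κ 0 with h | h | h
      · linarith
      · exact absurd h h2
      · exact absurd h h1
    rw [div_pow, Real.sq_sqrt h3.le, Real.cosh_sq]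
    field_simp
    ring

namespace ModelPlane

variable {κ : ℝ}

theorem abs_prod_le (hκ : 0 < κ) (x y : ModelPlane κ) : |prod x y| ≤ 1 := by
  have hx := x.mem_quadric
  have hy := y.mem_quadric
  rw [← sq_le_one_iff_abs_le_one]
  have h : 1 - prod x y ^ 2 = κ * ((x.u₀ * y.u₁ - x.u₁ * y.u₀) ^ 2
      + (x.u₀ * y.u₂ - x.u₂ * y.u₀) ^ 2) + κ ^ 2 * (x.u₁ * y.u₂ - x.u₂ * y.u₁) ^ 2 := by
    unfold prod
    linear_combination (-1) * hx - (x.u₀ ^ 2 + κ * (x.u₁ ^ 2 + x.u₂ ^ 2)) * hy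
  have : 0 ≤ 1 - prod x y ^ 2 := by rw [h]; positivity
  linarith

theorem one_le_prod (hκ : κ < 0) (x y : ModelPlane κ) : 1 ≤ prod x y := by
  have hx := x.mem_quadric
  have hy := y.mem_quadric
  have hx0 := x.upper_sheet hκ.le
  have hy0 := y.upper_sheet hκ.le
  have hk : 0 < -κ := by linarith
  have h : (1 + (-κ) * (x.u₁ * y.u₁ + x.u₂ * y.u₂)) ^ 2 ≤ (x.u₀ * y.u₀) ^ 2 := by
    have e : (x.u₀ * y.u₀) ^ 2 - (1 + (-κ) * (x.u₁ * y.u₁ + x.u₂ * y.u₂)) ^ 2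
        = (-κ) * ((x.u₁ - y.u₁) ^ 2 + (x.u₂ - y.u₂) ^ 2)
          + (-κ) ^ 2 * (x.u₁ * y.u₂ - x.u₂ * y.u₁) ^ 2 := by
      linear_combination y.u₀ ^ 2 * hx + (1 - κ * (x.u₁ ^ 2 + x.u₂ ^ 2)) * hy
    have : 0 ≤ (-κ) * ((x.u₁ - y.u₁) ^ 2 + (x.u₂ - y.u₂) ^ 2)
          + (-κ) ^ 2 * (x.u₁ * y.u₂ - x.u₂ * y.u₁) ^ 2 := by positivity
    linarith
  have := abs_le_of_sq_le_sq' h (by positivity)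
  unfold prod
  linarith [this.2]

theorem u₀_eq_one (x : ModelPlane 0) : x.u₀ = 1 := by
  have h := x.mem_quadric
  have h0 := x.upper_sheet le_rfl
  nlinarith

theorem modelCos_distance (hκ : κ ≠ 0) (x y : ModelPlane κ) :
    modelCos κ (x.distance y) = prod x y := by
  unfold modelCos distance
  rcases lt_or_gt_of_ne hκ with h | h
  · have h1 : ¬ 0 < κ := not_lt.2 h.le
    have h2 : Real.sqrt (-κ) ≠ 0 := (Real.sqrt_pos.2 (by linarith)).ne'
    simp only [h1, hκ, if_false]
    rw [mul_div_cancel₀ _ h2, Real.cosh_arcosh (one_le_prod h x y)]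
  · have h2 : Real.sqrt κ ≠ 0 := (Real.sqrt_pos.2 h).ne'
    simp only [h, if_true]
    have h3 := abs_le.1 (abs_prod_le h x y)
    rw [mul_div_cancel₀ _ h2, Real.cos_arccos h3.1 h3.2]

theorem modelSin_distance_nonneg (x y : ModelPlane κ) : 0 ≤ modelSin κ (x.distance y) := by
  unfold modelSin distance
  split_ifs with h h0
  · have h2 : Real.sqrt κ ≠ 0 := (Real.sqrt_pos.2 h).ne'
    rw [mul_div_cancel₀ _ h2]
    exact div_nonneg (Real.sin_nonneg_of_nonneg_of_le_pi (Real.arccos_nonneg _)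
      (Real.arccos_le_pi _)) (Real.sqrt_nonneg _)
  · exact Real.sqrt_nonneg _
  · have h1 : κ < 0 := lt_of_le_of_ne (not_lt.1 h) h0
    have h2 : Real.sqrt (-κ) ≠ 0 := (Real.sqrt_pos.2 (by linarith)).ne'
    rw [mul_div_cancel₀ _ h2]
    exact div_nonneg (Real.sinh_nonneg_iff.2 (Real.arcosh_nonneg (one_le_prod h1 x y)))
      (Real.sqrt_nonneg _)

theorem tangentInner_direction (hκ : κ ≠ 0) (p x y : ModelPlane κ) :
    tangentInner κ (direction p x) (direction p y)
      = (prod x y - prod p x * prod p y) / κ := by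
  have hp := p.mem_quadric
  have e : κ * tangentInner κ (direction p x) (direction p y)
      = prod x y - prod p x * prod p y := by
    have : κ * tangentInner κ (direction p x) (direction p y)
        = (x.u₀ - prod p x * p.u₀) * (y.u₀ - prod p y * p.u₀)
          + κ * ((x.u₁ - prod p x * p.u₁) * (y.u₁ - prod p y * p.u₁)
          + (x.u₂ - prod p x * p.u₂) * (y.u₂ - prod p y * p.u₂)) := by
      simp only [tangentInner, direction]
      field_simp
      ring
    rw [this]
    have h1 : p.u₀ * x.u₀ + κ * (p.u₁ * x.u₁ + p.u₂ * x.u₂) = prod p x := rfl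
    have h2 : p.u₀ * y.u₀ + κ * (p.u₁ * y.u₁ + p.u₂ * y.u₂) = prod p y := rfl
    have h3 : x.u₀ * y.u₀ + κ * (x.u₁ * y.u₁ + x.u₂ * y.u₂) = prod x y := rfl
    linear_combination h3 - prod p x * h2 - prod p y * h1 + prod p x * prod p y * hp
  rw [← e]
  field_simp

theorem prod_self (x : ModelPlane κ) : prod x x = 1 := by
  have := x.mem_quadric
  unfold prod
  linarith

/-- The law of cosines in the model plane. -/
theorem angle_eq (p x y : ModelPlane κ) :
    angle p x y =
      Real.arccos (cosineLaw κ (x.distance y) (p.distance y) (p.distance x)) := by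
  unfold angle
  congr 1
  by_cases hκ : κ = 0
  · subst hκ
    have hx := u₀_eq_one x
    have hy := u₀_eq_one y
    have hp := u₀_eq_one p
    have d : ∀ z w : ModelPlane 0,
        z.distance w = Real.sqrt ((z.u₁ - w.u₁) ^ 2 + (z.u₂ - w.u₂) ^ 2) := by
      intro z w; simp [distance]
    have sq : ∀ z w : ModelPlane 0,
        z.distance w ^ 2 = (z.u₁ - w.u₁) ^ 2 + (z.u₂ - w.u₂) ^ 2 := by
      intro z w; rw [d, Real.sq_sqrt (by positivity)]
    have t : ∀ z w : ModelPlane 0, tangentInner 0 (direction p z) (direction p w)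
        = (z.u₁ - p.u₁) * (w.u₁ - p.u₁) + (z.u₂ - p.u₂) * (w.u₂ - p.u₂) := by
      intro z w
      simp [tangentInner, direction, prod, u₀_eq_one]
    have t2 : ∀ z : ModelPlane 0, tangentInner 0 (direction p z) (direction p z)
        = p.distance z ^ 2 := by
      intro z; rw [t, sq]; ring
    have nn : ∀ z : ModelPlane 0, 0 ≤ p.distance z := by
      intro z; rw [d]; exact Real.sqrt_nonneg _
    rw [t2, t2, ← mul_pow, Real.sqrt_sq (mul_nonneg (nn _) (nn _)), t]
    simp only [cosineLaw, if_true]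
    rw [sq x y, sq p x, sq p y,
      show 2 * p.distance y * p.distance x = 2 * (p.distance x * p.distance y) by ring, ← div_div _ 2]
    congr 1
    ring
  · have t2 : ∀ z : ModelPlane κ, tangentInner κ (direction p z) (direction p z)
        = modelSin κ (p.distance z) ^ 2 := by
      intro z
      rw [tangentInner_direction hκ, prod_self, ← modelCos_distance hκ]
      have := modelCos_sq_add κ (p.distance z)
      rw [div_eq_iff hκ]
      linarith
    rw [t2, t2, ← mul_pow, Real.sqrt_sq (mul_nonneg (modelSin_distance_nonneg _ _)
      (modelSin_distance_nonneg _ _)), tangentInner_direction hκ]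
    simp only [cosineLaw, hκ, if_false]
    rw [modelCos_distance hκ, modelCos_distance hκ, modelCos_distance hκ, div_div]
    congr 1 <;> ring

end ModelPlane

/-- The model angle does not depend on the choice of the model triangle. -/
theorem modelAngle_eq_angle {κ a b c : ℝ} {p x y : ModelPlane κ}
    (h : IsModelTriangle κ a b c p x y) : modelAngle κ a b c = p.angle x y := by
  have H : ∃ T : ModelPlane κ × ModelPlane κ × ModelPlane κ,
      IsModelTriangle κ a b c T.1 T.2.1 T.2.2 := ⟨(p, x, y), h⟩
  unfold modelAngle
  rw [dif_pos H, ModelPlane.angle_eq, ModelPlane.angle_eq]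
  obtain ⟨h1, h2, h3⟩ := H.choose_spec
  obtain ⟨k1, k2, k3⟩ := h
  rw [h1, h2, h3, k1, k2, k3]

/-- The point of the model plane with polar coordinates `(r, θ)`. -/
def ModelPlane.polar (κ r θ : ℝ) : ModelPlane κ where
  u₀ := modelCos κ r
  u₁ := modelSin κ r * Real.cos θ
  u₂ := modelSin κ r * Real.sin θ
  mem_quadric := by
    have h := modelCos_sq_add κ r
    have := Real.sin_sq_add_cos_sq θ
    linear_combination h + κ * modelSin κ r ^ 2 * this
  upper_sheet := by
    intro h
    unfold modelCos
    rw [if_neg (not_lt.2 h)]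
    split_ifs
    · exact one_pos
    · exact Real.cosh_pos _

theorem ModelPlane.distance_of_prod_eq {κ a : ℝ} (hκ : κ ≠ 0) (ha : 0 ≤ a)
    (hπ : 0 < κ → Real.sqrt κ * a ≤ Real.pi) (x y : ModelPlane κ)
    (h : prod x y = modelCos κ a) : x.distance y = a := by
  unfold distance
  rw [h]
  unfold modelCos
  rcases lt_or_gt_of_ne hκ with h1 | h1
  · have h2 : 0 < Real.sqrt (-κ) := Real.sqrt_pos.2 (by linarith)
    simp only [not_lt.2 h1.le, hκ, if_false]
    rw [Real.arcosh_cosh (by positivity), mul_div_cancel_left₀ _ h2.ne']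
  · have h2 : 0 < Real.sqrt κ := Real.sqrt_pos.2 h1
    simp only [h1, if_true]
    rw [Real.arccos_cos (by positivity) (hπ h1), mul_div_cancel_left₀ _ h2.ne']

theorem modelSin_ne_zero {κ b : ℝ} (hb : 0 < b)
    (hπ : 0 < κ → Real.sqrt κ * b < Real.pi) : modelSin κ b ≠ 0 := by
  unfold modelSin
  split_ifs with h h0
  · have hs : 0 < Real.sqrt κ := Real.sqrt_pos.2 h
    exact (div_pos (Real.sin_pos_of_pos_of_lt_pi (by positivity) (hπ h)) hs).ne'
  · exact hb.ne'
  · have hs : 0 < Real.sqrt (-κ) := Real.sqrt_pos.2 (by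
      have := lt_of_le_of_ne (not_lt.1 h) h0; linarith)
    exact (div_pos (Real.sinh_pos_iff.2 (by positivity)) hs).ne'

theorem abs_cosineLaw_le_one {κ a b c : ℝ} (hb : 0 < b) (hc : 0 < c)
    (h1 : a ≤ b + c) (h2 : b ≤ c + a) (h3 : c ≤ a + b)
    (hπ : 0 < κ → Real.sqrt κ * (a + b + c) < 2 * Real.pi) : |cosineLaw κ a b c| ≤ 1 := by
  unfold cosineLaw modelCos modelSin
  rcases lt_trichotomy κ 0 with hκ | hκ | hκ
  · have hs : 0 < Real.sqrt (-κ) := Real.sqrt_pos.2 (by linarith)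
    have hss : Real.sqrt (-κ) ^ 2 = -κ := Real.sq_sqrt (by linarith)
    simp only [not_lt.2 hκ.le, hκ.ne, if_false]
    set s := Real.sqrt (-κ)
    have hB : 0 < Real.sinh (s * b) := Real.sinh_pos_iff.2 (by positivity)
    have hC : 0 < Real.sinh (s * c) := Real.sinh_pos_iff.2 (by positivity)
    have e : κ * (Real.sinh (s * b) / s) * (Real.sinh (s * c) / s)
        = -(Real.sinh (s * b) * Real.sinh (s * c)) := by
      have : κ = - s ^ 2 := by linarith
      rw [this]; field_simp
    have u := (Real.cosh_le_cosh (x := s * a) (y := s * b + s * c)).2 (by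
      rw [abs_of_nonneg (mul_nonneg hs.le (by linarith)), abs_of_nonneg (by positivity)]
      nlinarith)
    have l := (Real.cosh_le_cosh (x := s * b - s * c) (y := s * a)).2 (by
      rw [abs_of_nonneg (mul_nonneg hs.le (by linarith)), abs_le]
      constructor <;> nlinarith)
    rw [Real.cosh_add] at u
    rw [Real.cosh_sub] at l
    rw [e, div_neg, abs_neg, abs_div, abs_of_pos (mul_pos hB hC), div_le_one (mul_pos hB hC),
      abs_le]
    constructor <;> linarith
  · subst hκ
    simp only [if_true]
    have hbc : 0 < 2 * b * c := by positivity
    rw [abs_div, abs_of_pos hbc, div_le_one hbc, abs_le]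
    constructor <;> nlinarith
  · have hs : 0 < Real.sqrt κ := Real.sqrt_pos.2 hκ
    have hss : Real.sqrt κ ^ 2 = κ := Real.sq_sqrt hκ.le
    simp only [hκ, hκ.ne', if_true, if_false]
    have hp := hπ hκ
    set s := Real.sqrt κ
    have hsb : 0 < s * b := by positivity
    have hsc : 0 < s * c := by positivity
    have hsa : 0 ≤ s * a := mul_nonneg hs.le (by linarith)
    have i1 : s * a ≤ s * b + s * c := by nlinarith
    have i2 : s * b ≤ s * c + s * a := by nlinarith
    have i3 : s * c ≤ s * a + s * b := by nlinarith
    have i4 : s * a + s * b + s * c < 2 * Real.pi := by linarith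
    have hB : 0 < Real.sin (s * b) := Real.sin_pos_of_pos_of_lt_pi hsb (by linarith)
    have hC : 0 < Real.sin (s * c) := Real.sin_pos_of_pos_of_lt_pi hsc (by linarith)
    have e : κ * (Real.sin (s * b) / s) * (Real.sin (s * c) / s)
        = Real.sin (s * b) * Real.sin (s * c) := by
      rw [← hss]; field_simp
    have u : Real.cos (s * a) ≤ Real.cos (s * b - s * c) := by
      rw [← Real.cos_abs (s * b - s * c)]
      apply Real.cos_le_cos_of_nonneg_of_le_pi (abs_nonneg _) (by linarith)
      rw [abs_le]
      constructor <;> linarith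
    have l : Real.cos (s * b + s * c) ≤ Real.cos (s * a) := by
      rcases le_total (s * b + s * c) Real.pi with h | h
      · exact Real.cos_le_cos_of_nonneg_of_le_pi hsa h i1
      · rw [← Real.cos_two_pi_sub (s * b + s * c)]
        exact Real.cos_le_cos_of_nonneg_of_le_pi hsa (by linarith) (by linarith)
    rw [Real.cos_add] at l
    rw [Real.cos_sub] at u
    rw [e, abs_div, abs_of_pos (mul_pos hB hC), div_le_one (mul_pos hB hC), abs_le]
    constructor <;> linarith

theorem sqrt_mul_lt_of_lt_varpi {κ t : ℝ} (h : ENNReal.ofReal t < 2 * varpi κ) (hκ : 0 < κ) :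
    Real.sqrt κ * t < 2 * Real.pi := by
  have hs : 0 < Real.sqrt κ := Real.sqrt_pos.2 hκ
  have hp : 0 < 2 * (Real.pi / Real.sqrt κ) := by have := Real.pi_pos; positivity
  have e : 2 * varpi κ = ENNReal.ofReal (2 * (Real.pi / Real.sqrt κ)) := by
    rw [varpi, if_pos hκ, ENNReal.ofReal_mul (by norm_num)]
    simp
  rw [e, ENNReal.ofReal_lt_ofReal_iff hp, ← mul_div_assoc, lt_div_iff₀ hs] at h
  linarith

/-- Existence of the model triangle. -/
theorem exists_isModelTriangle {κ a b c : ℝ} (hb : 0 < b) (hc : 0 < c)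
    (h1 : a ≤ b + c) (h2 : b ≤ c + a) (h3 : c ≤ a + b)
    (hper : ENNReal.ofReal (a + b + c) < 2 * varpi κ) :
    ∃ p x y : ModelPlane κ, IsModelTriangle κ a b c p x y := by
  have hπ := sqrt_mul_lt_of_lt_varpi hper
  have ha : 0 ≤ a := by linarith
  have hcos := abs_le.1 (abs_cosineLaw_le_one hb hc h1 h2 h3 hπ)
  set φ := Real.arccos (cosineLaw κ a b c) with hφ
  have hφc : Real.cos φ = cosineLaw κ a b c := Real.cos_arccos hcos.1 hcos.2
  refine ⟨ModelPlane.polar κ 0 0, ModelPlane.polar κ c 0, ModelPlane.polar κ b φ, ?_⟩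
  by_cases hκ : κ = 0
  · subst hκ
    have hc2 := Real.sin_sq_add_cos_sq φ
    have e : 2 * b * c * Real.cos φ = b ^ 2 + c ^ 2 - a ^ 2 := by
      rw [hφc]; simp only [cosineLaw, if_true]; field_simp
    refine ⟨?_, ?_, ?_⟩ <;>
      simp only [ModelPlane.distance, ModelPlane.polar, modelSin, lt_irrefl, if_true, if_false]
    · rw [Real.sqrt_eq_iff_mul_self_eq (by positivity) ha]
      simp only [Real.cos_zero, Real.sin_zero]
      linear_combination (-1) * e + b ^ 2 * hc2
    · rw [Real.sqrt_eq_iff_mul_self_eq (by positivity) hb.le]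
      linear_combination b ^ 2 * hc2
    · rw [Real.sqrt_eq_iff_mul_self_eq (by positivity) hc.le]
      simp only [Real.cos_zero, Real.sin_zero]
      ring
  · have c0 : modelCos κ 0 = 1 := by simp [modelCos]
    have s0 : modelSin κ 0 = 0 := by simp [modelSin]
    have hs : 0 ≤ Real.sqrt κ := Real.sqrt_nonneg _
    refine ⟨?_, ?_, ?_⟩
    · refine ModelPlane.distance_of_prod_eq hκ ha (fun h => ?_) _ _ ?_
      · have := hπ h; nlinarith
      · have sb : modelSin κ b ≠ 0 := modelSin_ne_zero hb fun h => by
          have := hπ h; have : 0 < Real.sqrt κ := Real.sqrt_pos.2 h; nlinarith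
        have sc : modelSin κ c ≠ 0 := modelSin_ne_zero hc fun h => by
          have := hπ h; have : 0 < Real.sqrt κ := Real.sqrt_pos.2 h; nlinarith
        have e : κ * modelSin κ b * modelSin κ c * Real.cos φ
            = modelCos κ a - modelCos κ b * modelCos κ c := by
          rw [hφc]; simp only [cosineLaw, hκ, if_false]; field_simp
        simp only [ModelPlane.prod, ModelPlane.polar, Real.cos_zero, Real.sin_zero]
        linear_combination e
    · refine ModelPlane.distance_of_prod_eq hκ hb.le (fun h => ?_) _ _ ?_
      · have := hπ h; nlinarith
      · simp [ModelPlane.prod, ModelPlane.polar, c0, s0]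
    · refine ModelPlane.distance_of_prod_eq hκ hc.le (fun h => ?_) _ _ ?_
      · have := hπ h; nlinarith
      · simp [ModelPlane.prod, ModelPlane.polar, c0, s0]

/-- The law of cosines for the model angle. -/
theorem modelAngle_eq_arccos {κ a b c : ℝ} (hb : 0 < b) (hc : 0 < c)
    (h1 : a ≤ b + c) (h2 : b ≤ c + a) (h3 : c ≤ a + b)
    (hper : ENNReal.ofReal (a + b + c) < 2 * varpi κ) :
    modelAngle κ a b c = Real.arccos (cosineLaw κ a b c) := by
  obtain ⟨p, x, y, h⟩ := exists_isModelTriangle hb hc h1 h2 h3 hper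
  rw [modelAngle_eq_angle h, ModelPlane.angle_eq, h.1, h.2.1, h.2.2]

section Comparison

variable {X : Type*} [MetricSpace X]

/-- The model angle `∡̃κ(p; q, r)` of a triple of points is defined if `p` differs from `q` and `r`
and the perimeter of the triple is less than `2 ϖκ`. -/
def ComparisonAngleDefined (κ : ℝ) (p q r : X) : Prop :=
  p ≠ q ∧ p ≠ r ∧ edist p q + edist q r + edist r p < 2 * varpi κ

/-- The model angle `∡̃κ(p; q, r)` at `p` of a triple of points. -/
def comparisonAngle (κ : ℝ) (p q r : X) : ℝ :=
  modelAngle κ (dist q r) (dist p r) (dist p q)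

/-- The `CAT(κ)` (four-point) comparison for a quadruple of points. -/
def CATComparison (κ : ℝ) (p₁ p₂ x₁ x₂ : X) : Prop :=
  comparisonAngle κ p₁ x₁ x₂ ≤ comparisonAngle κ p₁ p₂ x₁ + comparisonAngle κ p₁ p₂ x₂ ∨
  comparisonAngle κ p₂ x₁ x₂ ≤ comparisonAngle κ p₂ p₁ x₁ + comparisonAngle κ p₂ p₁ x₂ ∨
  ¬ (ComparisonAngleDefined κ p₁ x₁ x₂ ∧ ComparisonAngleDefined κ p₁ p₂ x₁ ∧
    ComparisonAngleDefined κ p₁ p₂ x₂ ∧ ComparisonAngleDefined κ p₂ x₁ x₂ ∧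
    ComparisonAngleDefined κ p₂ p₁ x₁ ∧ ComparisonAngleDefined κ p₂ p₁ x₂)

/-- For a triple with defined model angle, the model angle is given by the law of cosines. -/
theorem ComparisonAngleDefined.eq_arccos {κ : ℝ} {p q r : X}
    (h : ComparisonAngleDefined κ p q r) :
    comparisonAngle κ p q r
      = Real.arccos (cosineLaw κ (dist q r) (dist p r) (dist p q)) := by
  obtain ⟨hq, hr, hper⟩ := h
  refine modelAngle_eq_arccos (dist_pos.2 hr) (dist_pos.2 hq) ?_ ?_ ?_ ?_
  · linarith [dist_triangle q p r, dist_comm p q]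
  · exact dist_triangle p q r
  · linarith [dist_triangle p r q, dist_comm q r]
  · rw [edist_dist, edist_dist, edist_dist, ← ENNReal.ofReal_add dist_nonneg dist_nonneg,
      ← ENNReal.ofReal_add (add_nonneg dist_nonneg dist_nonneg) dist_nonneg] at hper
    rw [dist_comm p r]
    convert hper using 2
    ring

end Comparison

/-- A metric space is `CAT(κ)` if every quadruple of points satisfies `CAT(κ)` comparison. -/
def IsCAT (κ : ℝ) (X : Type*) [MetricSpace X] : Prop :=
  ∀ p₁ p₂ x₁ x₂ : X, CATComparison κ p₁ p₂ x₁ x₂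

/-- A metric space is locally `CAT(κ)` if every point has a neighborhood in which every quadruple
of points satisfies `CAT(κ)` comparison. -/
def IsLocallyCAT (κ : ℝ) (X : Type*) [MetricSpace X] : Prop :=
  ∀ q : X, ∃ Ω ∈ 𝓝 q, ∀ p₁ ∈ Ω, ∀ p₂ ∈ Ω, ∀ x₁ ∈ Ω, ∀ x₂ ∈ Ω, CATComparison κ p₁ p₂ x₁ x₂

/-- A length space: the distance of any two points is the infimum of the lengths of the paths
joining them. -/
def IsLengthSpace (X : Type*) [MetricSpace X] : Prop :=
  ∀ x y : X, ⨅ γ : Path x y, eVariationOn γ Set.univ = edist x y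

/-- `γ` is a geodesic path (a constant-speed minimizing geodesic parametrized by `[0, 1]`)
from `x` to `y`. -/
def IsGeodesicPath {X : Type*} [MetricSpace X] (γ : unitInterval → X) (x y : X) : Prop :=
  γ 0 = x ∧ γ 1 = y ∧ ∀ s t : unitInterval, dist (γ s) (γ t) = |(s : ℝ) - t| * dist x y

/-- Any two points at distance `< R` are joined by a unique geodesic. -/
def UniquelyGeodesicBelow (R : ℝ≥0∞) (X : Type*) [MetricSpace X] : Prop :=
  ∀ x y : X, edist x y < R → ∃! γ : unitInterval → X, IsGeodesicPath γ x y

/-- Geodesics between points at distance `< R` depend continuously on their endpoint pairs: the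
geodesic paths `Γ (x, y)` from `x` to `y` define a continuous map from the pairs of points at
distance `< R` to the space of paths with the topology of uniform convergence. (The existential
quantifier picks the only possible `Γ` when geodesics are unique.) -/
def GeodesicsContinuousBelow (R : ℝ≥0∞) (X : Type*) [MetricSpace X] : Prop :=
  ∃ Γ : {p : X × X // edist p.1 p.2 < R} → C(unitInterval, X),
    (∀ p, IsGeodesicPath (Γ p) p.1.1 p.1.2) ∧ Continuous Γ

end

/-! The comparison is used in three forms: the four-point one, the comparison for a point on a side
of a triangle (`SideComparison`), and the comparison of upper angles with model angles
(`GoodTriangle`).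

(a) ⇒ (b). Let `m` and `m'` have nearly the same distances to `x` and to `y`, with sums close to
`|xy|`. At both points the model angle opposite to `xy` is nearly `π`, so the four-point comparison
makes the two model angles with the side `mm'` at one of them add up to almost `π`. Since `m` and
`m'` are nearly equidistant from `x` and from `y`, the law of cosines then forces `|mm'|` to be
small (`IsCAT.tendsto_dist_zero`). Stated along an arbitrary filter, this one estimate yields the
existence of division points (in a complete length space the approximate ones form a Cauchy
sequence), their uniqueness, and the continuity of geodesics.

(b) ⇒ (a). Locally, the four-point comparison gives the side comparison, hence monotone model
angles, hence good triangles. By the inheritance lemma `GoodTriangle.glue` a triangle cut into two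
good ones is good; this rests on the triangle inequality for upper angles and on opposite directions
making the angle `π`. Continuity of geodesics presents any triangle of perimeter less than `2 ϖκ` as
the image of a square, a fine grid of which has its cells in balls with good triangles; gluing the
pieces shows that the whole triangle is good. Good triangles return the side comparison everywhere.
To get back four points, put two model triangles on the opposite sides of `p₁p₂`. If the angles at
`p₁` or at `p₂` add up to at least `π`, the comparison is trivial; otherwise, degenerate cases
aside, the segment `x₁x₂` of the model crosses `p₁p₂`, and the triangle inequality through the
corresponding point of the space bounds `|x₁x₂|`.

The plane geometry is done with `modelMd` and `modelSin`, for which the law of cosines is one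
polynomial identity for all signs of `κ`. -/

/-! ### Trigonometry of the model plane, uniformly in `κ`. -/

/-- The solution of `m'' + κ m = 1`, `m 0 = 0`, `m' 0 = 0`. -/
noncomputable def modelMd (κ t : ℝ) : ℝ :=
  if κ = 0 then t ^ 2 / 2 else (1 - modelCos κ t) / κ

/-- The condition `t < ϖκ` for a real number `t`. -/
def BelowVarpi (κ t : ℝ) : Prop := 0 < κ → Real.sqrt κ * t < Real.pi

theorem BelowVarpi.mono {κ s t : ℝ} (h : BelowVarpi κ t) (hst : s ≤ t) : BelowVarpi κ s :=
  fun hκ => (mul_le_mul_of_nonneg_left hst (Real.sqrt_nonneg κ)).trans_lt (h hκ)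

theorem ofReal_lt_varpi {κ t : ℝ} : ENNReal.ofReal t < varpi κ ↔ BelowVarpi κ t := by
  unfold varpi BelowVarpi
  split_ifs with h
  · have hs : 0 < Real.sqrt κ := Real.sqrt_pos.2 h
    rw [ENNReal.ofReal_lt_ofReal_iff (div_pos Real.pi_pos hs), lt_div_iff₀ hs]
    simp [h, mul_comm]
  · simp [h]

theorem edist_lt_varpi {κ : ℝ} {X : Type*} [MetricSpace X] {x y : X} :
    edist x y < varpi κ ↔ BelowVarpi κ (dist x y) := by
  rw [edist_dist, ofReal_lt_varpi]

theorem ofReal_lt_two_varpi {κ t : ℝ} :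
    ENNReal.ofReal t < 2 * varpi κ ↔ BelowVarpi κ (t / 2) := by
  rw [← ofReal_lt_varpi, ENNReal.ofReal_div_of_pos (by norm_num)]
  rw [ENNReal.div_lt_iff (by simp) (by simp), mul_comm]
  simp

theorem modelCos_eq (κ t : ℝ) : modelCos κ t = 1 - κ * modelMd κ t := by
  unfold modelMd
  split_ifs with h
  · simp [h, modelCos]
  · field_simp; ring

theorem modelSin_sq (κ t : ℝ) :
    modelSin κ t ^ 2 = 2 * modelMd κ t - κ * modelMd κ t ^ 2 := by
  by_cases h : κ = 0
  · subst h; simp [modelSin, modelMd]; ring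
  · have := modelCos_sq_add κ t
    rw [modelCos_eq] at this
    have : κ * (modelSin κ t ^ 2) = κ * (2 * modelMd κ t - κ * modelMd κ t ^ 2) := by linarith
    exact mul_left_cancel₀ h this

theorem modelSin_zero (κ : ℝ) : modelSin κ 0 = 0 := by simp [modelSin]

theorem modelMd_zero (κ : ℝ) : modelMd κ 0 = 0 := by simp [modelMd, modelCos]

theorem modelSin_neg (κ t : ℝ) : modelSin κ (-t) = -modelSin κ t := by
  unfold modelSin; split_ifs <;> simp [neg_div]

theorem modelMd_neg (κ t : ℝ) : modelMd κ (-t) = modelMd κ t := by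
  unfold modelMd modelCos; split_ifs <;> simp

theorem modelSin_add (κ u v : ℝ) :
    modelSin κ (u + v) = modelSin κ u * (1 - κ * modelMd κ v)
      + (1 - κ * modelMd κ u) * modelSin κ v := by
  rw [← modelCos_eq, ← modelCos_eq]
  unfold modelSin modelCos
  split_ifs
  · rw [mul_add, Real.sin_add]; ring
  · ring
  · rw [mul_add, Real.sinh_add]; ring

theorem modelMd_add (κ u v : ℝ) :
    modelMd κ (u + v) = modelMd κ u + modelMd κ v - κ * modelMd κ u * modelMd κ v
      + modelSin κ u * modelSin κ v := by
  by_cases h0 : κ = 0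
  · subst h0; simp [modelMd, modelSin]; ring
  · have h : modelCos κ (u + v)
        = modelCos κ u * modelCos κ v - κ * (modelSin κ u * modelSin κ v) := by
      unfold modelSin modelCos
      split_ifs with h
      · have h2 : Real.sqrt κ ≠ 0 := (Real.sqrt_pos.2 h).ne'
        rw [mul_add, Real.cos_add]
        field_simp
        rw [Real.sq_sqrt h.le]; ring
      · have h3 : 0 < -κ := by
          have := lt_of_le_of_ne (not_lt.1 h) h0; linarith
        have h2 : Real.sqrt (-κ) ≠ 0 := (Real.sqrt_pos.2 h3).ne'
        rw [mul_add, Real.cosh_add]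
        field_simp
        rw [Real.sq_sqrt h3.le]; ring
    rw [modelCos_eq, modelCos_eq, modelCos_eq] at h
    apply mul_left_cancel₀ h0
    linarith

theorem modelSin_sub (κ u v : ℝ) :
    modelSin κ (u - v) = modelSin κ u * (1 - κ * modelMd κ v)
      - (1 - κ * modelMd κ u) * modelSin κ v := by
  rw [sub_eq_add_neg, modelSin_add, modelMd_neg, modelSin_neg]; ring

theorem modelMd_sub (κ u v : ℝ) :
    modelMd κ (u - v) = modelMd κ u + modelMd κ v - κ * modelMd κ u * modelMd κ v
      - modelSin κ u * modelSin κ v := by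
  rw [sub_eq_add_neg, modelMd_add, modelMd_neg, modelSin_neg]; ring

theorem modelMd_diff (κ u v : ℝ) :
    modelMd κ v - modelMd κ u = 2 * modelSin κ ((u + v) / 2) * modelSin κ ((v - u) / 2) := by
  have h1 := modelMd_add κ ((u + v) / 2) ((v - u) / 2)
  have h2 := modelMd_sub κ ((u + v) / 2) ((v - u) / 2)
  rw [show (u + v) / 2 + (v - u) / 2 = v by ring] at h1
  rw [show (u + v) / 2 - (v - u) / 2 = u by ring] at h2
  linarith

theorem modelSin_pos {κ t : ℝ} (ht : 0 < t) (h : BelowVarpi κ t) : 0 < modelSin κ t := by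
  unfold modelSin
  split_ifs with h0 h1
  · have hs : 0 < Real.sqrt κ := Real.sqrt_pos.2 h0
    exact div_pos (Real.sin_pos_of_pos_of_lt_pi (by positivity) (h h0)) hs
  · exact ht
  · have hs : 0 < Real.sqrt (-κ) := Real.sqrt_pos.2 (by
      have := lt_of_le_of_ne (not_lt.1 h0) h1; linarith)
    exact div_pos (Real.sinh_pos_iff.2 (by positivity)) hs

theorem modelSin_nonneg {κ t : ℝ} (ht : 0 ≤ t) (h : BelowVarpi κ t) : 0 ≤ modelSin κ t := by
  rcases ht.eq_or_lt with rfl | ht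
  · rw [modelSin_zero]
  · exact (modelSin_pos ht h).le

theorem belowVarpi_of_modelSin_pos {κ t : ℝ} (h : 0 < modelSin κ t)
    (h2 : BelowVarpi κ (t / 2)) : BelowVarpi κ t := by
  intro hκ
  have h2 := h2 hκ
  have hs : 0 < Real.sqrt κ := Real.sqrt_pos.2 hκ
  rw [modelSin, if_pos hκ] at h
  by_contra! hc
  have h3 : Real.sin (Real.sqrt κ * t - Real.pi) ≥ 0 :=
    Real.sin_nonneg_of_nonneg_of_le_pi (by linarith) (by linarith)
  rw [Real.sin_sub_pi] at h3
  have := (div_pos_iff_of_pos_right hs).1 h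
  linarith

/-- The product formula `modelMd_diff` needs only the half-sum below `ϖκ`: by the symmetry about
`ϖκ`, the larger argument may lie beyond it. This is why half-sums appear in all the order lemmas
and in `SmallTriangle`. -/
theorem modelMd_lt {κ u v : ℝ} (hu : 0 ≤ u) (huv : u < v) (h : BelowVarpi κ ((u + v) / 2)) :
    modelMd κ u < modelMd κ v := by
  have h1 := modelMd_diff κ u v
  have h2 := modelSin_pos (by linarith) h
  have h3 : 0 < modelSin κ ((v - u) / 2) := modelSin_pos (by linarith) (h.mono (by linarith))
  nlinarith [mul_pos h2 h3]

theorem modelMd_le {κ u v : ℝ} (hu : 0 ≤ u) (huv : u ≤ v) (h : BelowVarpi κ ((u + v) / 2)) :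
    modelMd κ u ≤ modelMd κ v := by
  rcases huv.eq_or_lt with rfl | huv
  · rfl
  · exact (modelMd_lt hu huv h).le

theorem le_of_modelMd_le {κ u v : ℝ} (hv : 0 ≤ v) (h : BelowVarpi κ ((u + v) / 2))
    (hm : modelMd κ u ≤ modelMd κ v) : u ≤ v := by
  by_contra! hc
  exact absurd (modelMd_lt hv hc (by rwa [add_comm])) (not_lt.2 hm)

theorem lt_of_modelMd_lt {κ u v : ℝ} (hv : 0 ≤ v) (h : BelowVarpi κ ((u + v) / 2))
    (hm : modelMd κ u < modelMd κ v) : u < v := by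
  have := le_of_modelMd_le hv h hm.le
  exact lt_of_le_of_ne this (fun e => by subst e; exact lt_irrefl _ hm)

theorem eq_of_modelMd_eq {κ u v : ℝ} (hu : 0 ≤ u) (hv : 0 ≤ v)
    (h : BelowVarpi κ ((u + v) / 2)) (hm : modelMd κ u = modelMd κ v) : u = v :=
  le_antisymm (le_of_modelMd_le hv h hm.le) (le_of_modelMd_le hu (by rwa [add_comm]) hm.ge)

theorem modelMd_nonneg {κ t : ℝ} : 0 ≤ modelMd κ t := by
  have h := modelMd_diff κ 0 t
  rw [modelMd_zero] at h
  have : 0 ≤ modelSin κ (t / 2) ^ 2 := sq_nonneg _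
  simp only [zero_add, sub_zero] at h
  nlinarith

theorem continuous_modelSin (κ : ℝ) : Continuous (modelSin κ) := by
  unfold modelSin
  split_ifs
  · fun_prop
  · fun_prop
  · fun_prop

theorem continuous_modelMd (κ : ℝ) : Continuous (modelMd κ) := by
  unfold modelMd modelCos
  split_ifs <;> fun_prop

theorem mul_modelMd_le_two {κ : ℝ} (t : ℝ) (hκ : 0 < κ) : κ * modelMd κ t ≤ 2 := by
  have h := modelCos_eq κ t
  have h1 : -1 ≤ modelCos κ t := by
    rw [modelCos, if_pos hκ]; exact Real.neg_one_le_cos _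
  linarith

/-! ### Hinges and pairs of adjacent hinges. -/

/-- The law of cosines: `modelMd` of the third side of a hinge with sides `b`, `c` and
angle `α`. -/
noncomputable def hingeMd (κ b c α : ℝ) : ℝ :=
  modelMd κ b + modelMd κ c - κ * modelMd κ b * modelMd κ c
    - modelSin κ b * modelSin κ c * Real.cos α

theorem hingeMd_comm (κ b c α : ℝ) : hingeMd κ b c α = hingeMd κ c b α := by
  unfold hingeMd; ring

theorem hingeMd_zero (κ b c : ℝ) : hingeMd κ b c 0 = modelMd κ (b - c) := by
  rw [modelMd_sub, hingeMd, Real.cos_zero, mul_one]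

theorem hingeMd_pi (κ b c : ℝ) : hingeMd κ b c Real.pi = modelMd κ (b + c) := by
  rw [modelMd_add, hingeMd, Real.cos_pi]; ring

theorem hingeMd_le_hingeMd_iff {κ b c α β : ℝ} (hb : 0 < modelSin κ b) (hc : 0 < modelSin κ c)
    (hα : 0 ≤ α) (hα' : α ≤ Real.pi) (hβ : 0 ≤ β) (hβ' : β ≤ Real.pi) :
    hingeMd κ b c α ≤ hingeMd κ b c β ↔ α ≤ β := by
  have h := Real.strictAntiOn_cos.le_iff_ge (a := β) (b := α) ⟨hβ, hβ'⟩ ⟨hα, hα'⟩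
  rw [← h]
  unfold hingeMd
  rw [sub_le_sub_iff_left, mul_le_mul_iff_right₀ (mul_pos hb hc)]

/-- A hinge in the model plane has a third side. -/
theorem exists_modelMd_eq_hingeMd {κ b c : ℝ} (hb : 0 ≤ b) (hc : 0 ≤ c) (hb' : BelowVarpi κ b)
    (hc' : BelowVarpi κ c) (α : ℝ) :
    ∃ x, 0 ≤ x ∧ x ≤ b + c ∧ (0 < κ → Real.sqrt κ * x ≤ Real.pi) ∧
      modelMd κ x = hingeMd κ b c α := by
  have sb := modelSin_nonneg hb hb'
  have sc := modelSin_nonneg hc hc'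
  have hl : modelMd κ |b - c| ≤ hingeMd κ b c α := by
    have : modelMd κ |b - c| = modelMd κ (b - c) := by
      rcases abs_choice (b - c) with h | h <;> rw [h]
      exact modelMd_neg _ _
    rw [this, modelMd_sub, hingeMd]
    nlinarith [mul_nonneg sb sc, Real.cos_le_one α]
  have hu : hingeMd κ b c α ≤ modelMd κ (b + c) := by
    rw [modelMd_add, hingeMd]
    nlinarith [mul_nonneg sb sc, Real.neg_one_le_cos α]
  have habs : |b - c| ≤ b + c := by rw [abs_le]; constructor <;> linarith
  by_cases hbc : 0 < κ → Real.sqrt κ * (b + c) ≤ Real.pi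
  · obtain ⟨x, hx, hxe⟩ := intermediate_value_Icc habs (continuous_modelMd κ).continuousOn
      ⟨hl, hu⟩
    exact ⟨x, (abs_nonneg _).trans hx.1, hx.2, fun hκ =>
      (mul_le_mul_of_nonneg_left hx.2 (Real.sqrt_nonneg _)).trans (hbc hκ), hxe⟩
  -- If `b + c` exceeds `ϖκ`, the intermediate value theorem is applied on an interval ending at
  -- `ϖκ`, where `modelMd` attains its maximum `2 / κ`.
  · push Not at hbc
    obtain ⟨hκ, hbc⟩ := hbc
    have hs : 0 < Real.sqrt κ := Real.sqrt_pos.2 hκ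
    have hb2 := hb' hκ
    have hc2 := hc' hκ
    have hab : |b - c| ≤ Real.pi / Real.sqrt κ := by
      rw [le_div_iff₀ hs, mul_comm]
      rcases abs_cases (b - c) with h | h <;> rw [h.1] <;> nlinarith
    have hu' : hingeMd κ b c α ≤ modelMd κ (Real.pi / Real.sqrt κ) := by
      have e : modelMd κ (Real.pi / Real.sqrt κ) = 2 / κ := by
        rw [modelMd, if_neg hκ.ne', modelCos, if_pos hκ, mul_div_cancel₀ _ hs.ne', Real.cos_pi]
        norm_num
      rw [e, le_div_iff₀ hκ]
      nlinarith [mul_modelMd_le_two (b + c) hκ]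
    obtain ⟨x, hx, hxe⟩ := intermediate_value_Icc hab (continuous_modelMd κ).continuousOn
      ⟨hl, hu'⟩
    have h3 := hx.2
    rw [le_div_iff₀ hs] at h3
    refine ⟨x, (abs_nonneg _).trans hx.1, ?_, fun _ => by linarith, hxe⟩
    nlinarith

/-- For a hinge with vertex `a`, sides `b = |ap|`, `r = |az|` and angle `α`: the radial component
at `z` of the tangent vector of length `modelSin |zp|` pointing to `p`. The other component is
`modelSin b * sin α`. -/
noncomputable def hingeRadial (κ b r α : ℝ) : ℝ :=
  modelSin κ r * (1 - κ * modelMd κ b) - modelSin κ b * (1 - κ * modelMd κ r) * Real.cos α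

/-- Pythagoras for the tangent vector at `z`: by `modelSin_sq` the right-hand side is the square of
`modelSin` of the third side. -/
theorem hingeRadial_sq_add (κ b r α : ℝ) :
    hingeRadial κ b r α ^ 2 + (modelSin κ b * Real.sin α) ^ 2
      = 2 * hingeMd κ b r α - κ * hingeMd κ b r α ^ 2 := by
  have hb := modelSin_sq κ b
  have hr := modelSin_sq κ r
  have ht := Real.sin_sq_add_cos_sq α
  unfold hingeRadial hingeMd
  linear_combination modelSin κ b ^ 2 * ht
    + (modelSin κ b ^ 2 * Real.cos α ^ 2 * κ + (1 - κ * modelMd κ b) ^ 2) * hr + hb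

/-- The law of cosines at the other end `z` of the common side: the radial component is `modelSin`
of the third side times the cosine of the angle at `z`. -/
theorem modelSin_mul_hingeRadial (κ b r α : ℝ) :
    modelSin κ r * hingeRadial κ b r α
      = hingeMd κ b r α + modelMd κ r - κ * hingeMd κ b r α * modelMd κ r - modelMd κ b := by
  have hr := modelSin_sq κ r
  unfold hingeRadial hingeMd
  linear_combination (1 - κ * modelMd κ b) * hr

/-- The law of cosines seen from the far end `z` of the common side. The last bracket is the scalar
product of the two tangent vectors at `z`; the sign is negative because their tangential components
point to opposite sides. -/
theorem hingeMd_add (κ b c r α β : ℝ) :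
    hingeMd κ b c (α + β)
      = hingeMd κ b r α + hingeMd κ c r β - κ * hingeMd κ b r α * hingeMd κ c r β
        - (hingeRadial κ b r α * hingeRadial κ c r β
          - modelSin κ b * Real.sin α * (modelSin κ c * Real.sin β)) := by
  have hr := modelSin_sq κ r
  unfold hingeRadial hingeMd
  rw [Real.cos_add]
  linear_combination ((1 - κ * modelMd κ b) * (1 - κ * modelMd κ c)
    + κ * modelSin κ b * modelSin κ c * Real.cos α * Real.cos β) * hr

theorem hingeRadial_sq_add_eq {κ b r α u : ℝ} (hu : modelMd κ u = hingeMd κ b r α) :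
    hingeRadial κ b r α ^ 2 + (modelSin κ b * Real.sin α) ^ 2 = modelSin κ u ^ 2 := by
  rw [hingeRadial_sq_add, modelSin_sq, hu]

/-- The triangle inequality for two adjacent hinges. -/
theorem hingeMd_add_le {κ b c r α β u v : ℝ} (hu : modelMd κ u = hingeMd κ b r α)
    (hv : modelMd κ v = hingeMd κ c r β) (su : 0 ≤ modelSin κ u) (sv : 0 ≤ modelSin κ v) :
    hingeMd κ b c (α + β) ≤ modelMd κ (u + v) := by
  rw [hingeMd_add κ b c r, modelMd_add, hu, hv]
  have h1 := hingeRadial_sq_add_eq hu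
  have h2 := hingeRadial_sq_add_eq hv
  set f1 := hingeRadial κ b r α
  set g1 := hingeRadial κ c r β
  set f2 := modelSin κ b * Real.sin α
  set g2 := modelSin κ c * Real.sin β
  -- Cauchy–Schwarz for the vectors `(f1, f2)` and `(g1, -g2)`.
  have : -(f1 * g1 - f2 * g2) ≤ modelSin κ u * modelSin κ v := by
    apply le_of_sq_le_sq _ (mul_nonneg su sv)
    rw [mul_pow, ← h1, ← h2]
    nlinarith [sq_nonneg (f1 * g2 + f2 * g1)]
  linarith

/-- If there is equality in the triangle inequality for two adjacent hinges, then the common side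
meets the third one at two angles whose sum is `π`. -/
theorem hingeRadial_add_eq_zero {κ b c r α β u v : ℝ} (hu : modelMd κ u = hingeMd κ b r α)
    (hv : modelMd κ v = hingeMd κ c r β)
    (h : hingeMd κ b c (α + β) = modelMd κ (u + v)) :
    hingeRadial κ b r α * modelSin κ v + hingeRadial κ c r β * modelSin κ u = 0 := by
  rw [hingeMd_add κ b c r, modelMd_add, hu, hv] at h
  have h1 := hingeRadial_sq_add_eq hu
  have h2 := hingeRadial_sq_add_eq hv
  set f1 := hingeRadial κ b r α
  set g1 := hingeRadial κ c r β
  set f2 := modelSin κ b * Real.sin α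
  set g2 := modelSin κ c * Real.sin β
  -- The equality case of Cauchy–Schwarz: the rescaled vectors are opposite, so their sum has length
  -- zero.
  have e : (f1 * modelSin κ v + g1 * modelSin κ u) ^ 2
      + (f2 * modelSin κ v - g2 * modelSin κ u) ^ 2 = 0 := by
    linear_combination modelSin κ v ^ 2 * h1 + modelSin κ u ^ 2 * h2
      - 2 * modelSin κ u * modelSin κ v * h
  have := sq_nonneg (f1 * modelSin κ v + g1 * modelSin κ u)
  have := sq_nonneg (f2 * modelSin κ v - g2 * modelSin κ u)
  exact pow_eq_zero_iff (two_ne_zero) |>.1 (by linarith)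

/-- A segment with endpoints on the sides of two adjacent hinges crosses the common side. -/
theorem exists_crossing {κ b c R α β : ℝ} (hb : 0 < b) (hc : 0 < c) (hR : 0 ≤ R)
    (hb' : BelowVarpi κ b) (hc' : BelowVarpi κ c) (hR' : BelowVarpi κ R)
    (hα : 0 < α) (hβ : 0 < β) (hαβ : α + β < Real.pi)
    (hD : 0 ≤ hingeRadial κ b R α * (modelSin κ c * Real.sin β)
      + modelSin κ b * Real.sin α * hingeRadial κ c R β) :
    ∃ r x y, 0 < r ∧ r ≤ R ∧ 0 ≤ x ∧ 0 ≤ y ∧ BelowVarpi κ (x + y) ∧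
      modelMd κ x = hingeMd κ b r α ∧ modelMd κ y = hingeMd κ c r β ∧
      modelMd κ (x + y) = hingeMd κ b c (α + β) := by
  have sb := modelSin_pos hb hb'
  have sc := modelSin_pos hc hc'
  have s1 := Real.sin_pos_of_pos_of_lt_pi hα (by linarith)
  have s2 := Real.sin_pos_of_pos_of_lt_pi hβ (by linarith)
  have s12 := Real.sin_pos_of_pos_of_lt_pi (by linarith : 0 < α + β) hαβ
  -- This function is the cross product of the tangent vectors at the point at distance `r` along
  -- the common side, pointing to the two outer ends. It is negative at `r = 0`, nonnegative at `R`
  -- by `hD`, and its zero is the crossing.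
  have hcont : Continuous fun r => hingeRadial κ b r α * (modelSin κ c * Real.sin β)
      + modelSin κ b * Real.sin α * hingeRadial κ c r β := by
    have := continuous_modelMd κ
    have := continuous_modelSin κ
    unfold hingeRadial
    fun_prop
  have h0 : hingeRadial κ b 0 α * (modelSin κ c * Real.sin β)
      + modelSin κ b * Real.sin α * hingeRadial κ c 0 β < 0 := by
    have e : hingeRadial κ b 0 α * (modelSin κ c * Real.sin β)
      + modelSin κ b * Real.sin α * hingeRadial κ c 0 β
      = -(modelSin κ b * modelSin κ c * Real.sin (α + β)) := by
      simp only [hingeRadial, modelSin_zero, modelMd_zero, Real.sin_add]; ring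
    rw [e]
    have := mul_pos (mul_pos sb sc) s12
    linarith
  obtain ⟨r, hr, hD0⟩ := intermediate_value_Icc hR hcont.continuousOn ⟨h0.le, hD⟩
  simp only at hD0
  have hr0 : 0 < r := lt_of_le_of_ne hr.1 (fun e => by subst e; exact h0.ne hD0)
  have hr' := hR'.mono hr.2
  have sr := modelSin_pos hr0 hr'
  obtain ⟨x, hx, -, hxπ, hxe⟩ := exists_modelMd_eq_hingeMd hb.le hr0.le hb' hr' α
  obtain ⟨y, hy, -, hyπ, hye⟩ := exists_modelMd_eq_hingeMd hc.le hr0.le hc' hr' β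
  have nn : ∀ t, 0 ≤ t → (0 < κ → Real.sqrt κ * t ≤ Real.pi) → 0 ≤ modelSin κ t := by
    intro t ht h
    by_cases hκ : 0 < κ
    · rw [modelSin, if_pos hκ]
      exact div_nonneg (Real.sin_nonneg_of_nonneg_of_le_pi (by positivity) (h hκ))
        (Real.sqrt_nonneg _)
    · exact modelSin_nonneg ht fun h => absurd h hκ
  have sx := nn x hx hxπ
  have sy := nn y hy hyπ
  have q1 := hingeRadial_sq_add_eq hxe
  have q2 := hingeRadial_sq_add_eq hye
  have hf2 : 0 < modelSin κ b * Real.sin α := mul_pos sb s1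
  have hg2 : 0 < modelSin κ c * Real.sin β := mul_pos sc s2
  have key := hingeMd_add κ b c r α β
  -- An area identity that fixes a sign: the bracket is a positive multiple of `modelSin κ (x + y)`,
  -- so that `x + y` is less than `ϖκ` and the segment is the short one.
  have area : modelSin κ r * (modelSin κ b * Real.sin α * (1 - κ * modelMd κ y)
      + modelSin κ c * Real.sin β * (1 - κ * modelMd κ x))
      = modelSin κ b * modelSin κ c * Real.sin (α + β) := by
    have hr := modelSin_sq κ r
    rw [hxe, hye, Real.sin_add]
    unfold hingeRadial at hD0
    unfold hingeMd
    linear_combination (1 - κ * modelMd κ r) * hD0 + κ * modelSin κ b * modelSin κ c *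
      (Real.sin α * Real.cos β + Real.cos α * Real.sin β) * hr
  have hpos : 0 < modelSin κ b * Real.sin α * (1 - κ * modelMd κ y)
      + modelSin κ c * Real.sin β * (1 - κ * modelMd κ x) := by
    have : 0 < modelSin κ b * modelSin κ c * Real.sin (α + β) := mul_pos (mul_pos sb sc) s12
    rw [← area] at this
    exact (mul_pos_iff_of_pos_left sr).1 this
  set f1 := hingeRadial κ b r α
  set g1 := hingeRadial κ c r β
  set f2 := modelSin κ b * Real.sin α
  set g2 := modelSin κ c * Real.sin β
  have sx' : 0 < modelSin κ x := lt_of_le_of_ne sx (fun e => by rw [← e] at q1; nlinarith)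
  have sxy : modelSin κ x * g2 = modelSin κ y * f2 := by
    have : (modelSin κ x * g2) ^ 2 = (modelSin κ y * f2) ^ 2 := by
      linear_combination -g2 ^ 2 * q1 + f2 ^ 2 * q2 + (f1 * g2 - f2 * g1) * hD0
    exact (sq_eq_sq₀ (by positivity) (by positivity)).1 this
  refine ⟨r, x, y, hr0, hr.2, hx, hy, ?_, hxe, hye, ?_⟩
  · apply belowVarpi_of_modelSin_pos
    · rw [modelSin_add]
      have : f2 * (modelSin κ x * (1 - κ * modelMd κ y) + (1 - κ * modelMd κ x) * modelSin κ y)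
          = modelSin κ x * (f2 * (1 - κ * modelMd κ y) + g2 * (1 - κ * modelMd κ x)) := by
        linear_combination -(1 - κ * modelMd κ x) * sxy
      have h2 := mul_pos sx' hpos
      rw [← this] at h2
      exact (mul_pos_iff_of_pos_left hf2).1 h2
    · intro hκ
      have h1 := hxπ hκ
      have h2 := hyπ hκ
      by_contra! hcon
      have e : Real.sqrt κ * x = Real.pi := by linarith
      rw [modelSin, if_pos hκ, e] at sx'
      simp at sx'
  · rw [key, modelMd_add, hxe, hye]
    have : modelSin κ x * modelSin κ y = -(f1 * g1 - f2 * g2) := by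
      have e1 : f2 * (modelSin κ x * modelSin κ y) = f2 * (-(f1 * g1 - f2 * g2)) := by
        have : f2 * (modelSin κ x * modelSin κ y) = modelSin κ x ^ 2 * g2 := by
          linear_combination -modelSin κ x * sxy
        rw [this, ← q1]
        linear_combination f1 * hD0
      exact mul_left_cancel₀ hf2.ne' e1
    linarith

/-! ### Model angles, Alexandrov's lemma and the comparison for a point on a side. -/

section Triangles

variable {X : Type*} [MetricSpace X] {κ : ℝ} {a b c p q r x y z w : X}

/-- The point `z` lies between `b` and `c`: there is equality in the triangle inequality. -/
def MetricBetween (b z c : X) : Prop := dist b z + dist z c = dist b c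

theorem MetricBetween.symm (h : MetricBetween b z c) : MetricBetween c z b := by
  unfold MetricBetween at *
  rw [dist_comm c z, dist_comm z b, dist_comm c b]; linarith

theorem MetricBetween.left (b c : X) : MetricBetween b b c := by simp [MetricBetween]

theorem MetricBetween.right (b c : X) : MetricBetween b c c := by simp [MetricBetween]

theorem MetricBetween.trans (h : MetricBetween b z c) (hw : MetricBetween b w z) :
    MetricBetween b w c ∧ MetricBetween w z c := by
  unfold MetricBetween at *
  have := dist_triangle b w c
  have := dist_triangle w z c
  constructor <;> linarith

/-- The perimeter of the triangle is less than `2 ϖκ`. -/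
def SmallTriangle (κ : ℝ) (a b c : X) : Prop :=
  BelowVarpi κ ((dist a b + dist b c + dist c a) / 2)

theorem SmallTriangle.rotate (h : SmallTriangle κ a b c) : SmallTriangle κ b c a :=
  h.mono (by linarith)

theorem SmallTriangle.swap (h : SmallTriangle κ a b c) : SmallTriangle κ a c b :=
  h.mono (by rw [dist_comm a c, dist_comm c b, dist_comm b a]; linarith)

theorem SmallTriangle.side (h : SmallTriangle κ a b c) : BelowVarpi κ (dist a b) :=
  h.mono (by linarith [dist_triangle a c b, dist_comm a c, dist_comm c b])

theorem SmallTriangle.sub (h : SmallTriangle κ a b c) (hz : MetricBetween b z c) :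
    SmallTriangle κ a b z := by
  unfold MetricBetween at hz
  exact h.mono (by linarith [dist_triangle z c a, dist_comm a c])

theorem comparisonAngleDefined_iff :
    ComparisonAngleDefined κ p q r ↔ p ≠ q ∧ p ≠ r ∧ SmallTriangle κ p q r := by
  unfold ComparisonAngleDefined SmallTriangle
  rw [← ofReal_lt_two_varpi, ENNReal.ofReal_add (by positivity) (by positivity),
    ENNReal.ofReal_add (by positivity) (by positivity), edist_dist, edist_dist, edist_dist]

theorem comparisonAngle_nonneg (κ : ℝ) (p q r : X) : 0 ≤ comparisonAngle κ p q r := by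
  unfold comparisonAngle modelAngle
  split_ifs
  · exact Real.arccos_nonneg _
  · rfl

theorem comparisonAngle_le_pi (κ : ℝ) (p q r : X) : comparisonAngle κ p q r ≤ Real.pi := by
  unfold comparisonAngle modelAngle
  split_ifs
  · exact Real.arccos_le_pi _
  · exact Real.pi_pos.le

theorem SmallTriangle.modelSin_pos (h : SmallTriangle κ a b c) (hab : a ≠ b) :
    0 < modelSin κ (dist a b) :=
  _root_.modelSin_pos (dist_pos.2 hab) h.side

theorem SmallTriangle.eq_hingeMd (h : SmallTriangle κ p q r) (hq : p ≠ q) (hr : p ≠ r) :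
    modelMd κ (dist q r) = hingeMd κ (dist p q) (dist p r) (comparisonAngle κ p q r) := by
  have hd : ComparisonAngleDefined κ p q r := comparisonAngleDefined_iff.2 ⟨hq, hr, h⟩
  have s1 := (h.modelSin_pos hq).ne'
  have s2 := (h.swap.modelSin_pos hr).ne'
  have hper : 0 < κ → Real.sqrt κ * (dist q r + dist p r + dist p q) < 2 * Real.pi := by
    intro hκ
    have := h hκ
    rw [dist_comm r p] at this
    linarith
  have habs := abs_le.1 (abs_cosineLaw_le_one (κ := κ) (dist_pos.2 hr) (dist_pos.2 hq)
    (by linarith [dist_triangle q p r, dist_comm p q]) (dist_triangle p q r)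
    (by linarith [dist_triangle p r q, dist_comm q r]) hper)
  rw [hd.eq_arccos, hingeMd, Real.cos_arccos habs.1 habs.2]
  unfold cosineLaw
  split_ifs with h0
  · subst h0
    have d1 := (dist_pos.2 hq).ne'
    have d2 := (dist_pos.2 hr).ne'
    simp only [modelMd, modelSin, if_true, lt_irrefl, if_false]
    field_simp
    ring
  · rw [modelCos_eq, modelCos_eq, modelCos_eq]
    field_simp
    ring

theorem SmallTriangle.comparisonAngle_le_iff (h : SmallTriangle κ p q r) (hq : p ≠ q)
    (hr : p ≠ r) {θ : ℝ} (h0 : 0 ≤ θ) (hπ : θ ≤ Real.pi) :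
    comparisonAngle κ p q r ≤ θ ↔
      modelMd κ (dist q r) ≤ hingeMd κ (dist p q) (dist p r) θ := by
  rw [h.eq_hingeMd hq hr, hingeMd_le_hingeMd_iff (h.modelSin_pos hq) (h.swap.modelSin_pos hr)
    (comparisonAngle_nonneg _ _ _ _) (comparisonAngle_le_pi _ _ _ _) h0 hπ]

theorem SmallTriangle.le_comparisonAngle_iff (h : SmallTriangle κ p q r) (hq : p ≠ q)
    (hr : p ≠ r) {θ : ℝ} (h0 : 0 ≤ θ) (hπ : θ ≤ Real.pi) :
    θ ≤ comparisonAngle κ p q r ↔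
      hingeMd κ (dist p q) (dist p r) θ ≤ modelMd κ (dist q r) := by
  rw [h.eq_hingeMd hq hr, hingeMd_le_hingeMd_iff (h.modelSin_pos hq) (h.swap.modelSin_pos hr)
    h0 hπ (comparisonAngle_nonneg _ _ _ _) (comparisonAngle_le_pi _ _ _ _)]

theorem SmallTriangle.comparisonAngle_comm (h : SmallTriangle κ p q r) (hq : p ≠ q)
    (hr : p ≠ r) : comparisonAngle κ p q r = comparisonAngle κ p r q := by
  apply le_antisymm
  · rw [h.comparisonAngle_le_iff hq hr (comparisonAngle_nonneg _ _ _ _)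
      (comparisonAngle_le_pi _ _ _ _), hingeMd_comm, ← h.swap.eq_hingeMd hr hq, dist_comm]
  · rw [h.swap.comparisonAngle_le_iff hr hq (comparisonAngle_nonneg _ _ _ _)
      (comparisonAngle_le_pi _ _ _ _), hingeMd_comm, ← h.eq_hingeMd hq hr, dist_comm]

theorem MetricBetween.comparisonAngle_eq_pi (hz : MetricBetween b z c)
    (h : SmallTriangle κ z b c) (hb : z ≠ b) (hc : z ≠ c) :
    comparisonAngle κ z b c = Real.pi := by
  apply le_antisymm (comparisonAngle_le_pi _ _ _ _)
  rw [h.le_comparisonAngle_iff hb hc Real.pi_pos.le le_rfl, hingeMd_pi, dist_comm z b, hz]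

theorem comparisonAngle_eq_zero (h : SmallTriangle κ p x y) (hx : p ≠ x)
    (hxy : MetricBetween p x y) : comparisonAngle κ p x y = 0 := by
  have hy : p ≠ y := by
    rintro rfl
    have := dist_pos.2 hx
    unfold MetricBetween at hxy
    rw [dist_self] at hxy
    linarith [dist_nonneg (x := x) (y := p)]
  apply le_antisymm _ (comparisonAngle_nonneg _ _ _ _)
  rw [h.comparisonAngle_le_iff hx hy le_rfl Real.pi_pos.le, hingeMd_zero, ← modelMd_neg κ (_ - _)]
  unfold MetricBetween at hxy
  rw [show -(dist p x - dist p y) = dist x y by linarith]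

/-- Comparison of the distance from `a` to a point `z` between `b` and `c` with the
corresponding distance in the model triangle. -/
def SideComparison (κ : ℝ) (a b c z : X) : Prop :=
  modelSin κ (dist b z + dist z c) * modelMd κ (dist a z) ≤
    modelSin κ (dist z c) * (modelMd κ (dist a b) - modelMd κ (dist b z))
      + modelSin κ (dist b z) * (modelMd κ (dist a c) - modelMd κ (dist z c))

theorem SideComparison.symm (h : SideComparison κ a b c z) : SideComparison κ a c b z := by
  unfold SideComparison at *
  rw [dist_comm c z, dist_comm z b, add_comm (dist z c)]
  linarith

/-- Combining the laws of cosines at `z` with weights `modelSin |zc|` and `modelSin |zb|` turns the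
difference of the two sides of `SideComparison` into a positive multiple of the sum of the cosines
of the two angles, and that sum is nonpositive exactly when the angles add up to at least `π`. -/
theorem SmallTriangle.pi_le_add_iff (hb : SmallTriangle κ z a b) (hc : SmallTriangle κ z a c)
    (za : z ≠ a) (zb : z ≠ b) (zc : z ≠ c) :
    Real.pi ≤ comparisonAngle κ z a b + comparisonAngle κ z a c ↔ SideComparison κ a b c z := by
  have e1 := hb.eq_hingeMd za zb
  have e2 := hc.eq_hingeMd za zc
  have sa := hb.modelSin_pos za
  have sb := hb.swap.modelSin_pos zb
  have sc := hc.swap.modelSin_pos zc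
  have n1 := comparisonAngle_nonneg κ z a b
  have n2 := comparisonAngle_nonneg κ z a c
  have l1 := comparisonAngle_le_pi κ z a b
  have l2 := comparisonAngle_le_pi κ z a c
  set ζ₁ := comparisonAngle κ z a b
  set ζ₂ := comparisonAngle κ z a c
  have h1 : Real.pi ≤ ζ₁ + ζ₂ ↔ Real.cos ζ₁ + Real.cos ζ₂ ≤ 0 := by
    have h := Real.strictAntiOn_cos.le_iff_ge (a := ζ₁) (b := Real.pi - ζ₂) ⟨n1, l1⟩
      ⟨by linarith, by linarith⟩
    rw [Real.cos_pi_sub] at h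
    constructor
    · intro h2; have := h.2 (by linarith); linarith
    · intro h2; have := h.1 (by linarith); linarith
  rw [h1, SideComparison, dist_comm a z, dist_comm b z, modelSin_add, ← sub_nonpos (b := _ + _)]
  unfold hingeMd at e1 e2
  have e : modelSin κ (dist z a) * modelSin κ (dist z b) * modelSin κ (dist z c)
      * (Real.cos ζ₁ + Real.cos ζ₂) =
      (modelSin κ (dist z b) * (1 - κ * modelMd κ (dist z c)) +
              (1 - κ * modelMd κ (dist z b)) * modelSin κ (dist z c)) *
            modelMd κ (dist z a) -
          (modelSin κ (dist z c) * (modelMd κ (dist a b) - modelMd κ (dist z b)) +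
            modelSin κ (dist z b) * (modelMd κ (dist a c) - modelMd κ (dist z c))) := by
    linear_combination modelSin κ (dist z c) * e1 + modelSin κ (dist z b) * e2
  rw [← e]
  have hp := mul_pos (mul_pos sa sb) sc
  constructor
  · intro h; nlinarith
  · intro h; by_contra! h3; nlinarith

/-- Stewart's formula: the right-hand side of `SideComparison` is the one computed from the hinge at
`b`, after elimination of the cosine of the model angle there. -/
theorem SmallTriangle.sideComparison_iff (h : SmallTriangle κ b a c) (hz : MetricBetween b z c)
    (ba : b ≠ a) (bc : b ≠ c) :
    SideComparison κ a b c z ↔ modelMd κ (dist a z) ≤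
      hingeMd κ (dist b a) (dist b z) (comparisonAngle κ b a c) := by
  have e := h.eq_hingeMd ba bc
  have s := h.swap.modelSin_pos bc
  unfold MetricBetween at hz
  rw [← mul_le_mul_iff_right₀ s, SideComparison, hz]
  unfold hingeMd at *
  have hu := modelSin_sq κ (dist b z)
  rw [← hz, modelMd_add, modelSin_add] at e
  rw [← hz, modelSin_add, dist_comm b a] at *
  have k : modelSin κ (dist z c) * (modelMd κ (dist a b) - modelMd κ (dist b z))
      + modelSin κ (dist b z) * (modelMd κ (dist a c) - modelMd κ (dist z c))
      = (modelSin κ (dist b z) * (1 - κ * modelMd κ (dist z c)) +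
          (1 - κ * modelMd κ (dist b z)) * modelSin κ (dist z c)) *
        (modelMd κ (dist a b) + modelMd κ (dist b z) - κ * modelMd κ (dist a b) * modelMd κ (dist b z)
          - modelSin κ (dist a b) * modelSin κ (dist b z) *
            Real.cos (comparisonAngle κ b a c)) := by
    linear_combination modelSin κ (dist b z) * e
      + modelSin κ (dist z c) * (1 - κ * modelMd κ (dist a b)) * hu
  rw [k]

/-- If the sum exceeded `π`, shrinking the second angle to the supplement of the first would replace
`|zc|` by a smaller `v`. The two hinges then form a straight angle, so `modelMd (|ab| + |ac|)` is at
most `modelMd (|bz| + v)`, which is less than `modelMd |bc|`, against the triangle inequality. -/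
theorem comparisonAngle_add_le_pi (h : SmallTriangle κ a b c) (hz : MetricBetween b z c)
    (ab : a ≠ b) (ac : a ≠ c) (az : a ≠ z) :
    comparisonAngle κ a b z + comparisonAngle κ a c z ≤ Real.pi := by
  by_contra! hcon
  have hb := h.sub hz
  have hc := h.swap.sub hz.symm
  have e1 := hb.eq_hingeMd ab az
  have e2 := hc.eq_hingeMd ac az
  have e3 := h.eq_hingeMd ab ac
  have n1 := comparisonAngle_nonneg κ a b z
  have n2 := comparisonAngle_nonneg κ a c z
  have l1 := comparisonAngle_le_pi κ a b z
  have l2 := comparisonAngle_le_pi κ a c z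
  have sb := hb.modelSin_pos ab
  have sc := hc.modelSin_pos ac
  have sz := hb.swap.modelSin_pos az
  obtain ⟨v, hv0, -, hvπ, hve⟩ := exists_modelMd_eq_hingeMd (κ := κ) (b := dist a c)
    (c := dist a z) dist_nonneg dist_nonneg hc.side hb.swap.side
    (Real.pi - comparisonAngle κ a b z)
  have hzc : BelowVarpi κ (dist c z) := hc.rotate.side
  have hvlt : v < dist c z := by
    apply lt_of_modelMd_lt dist_nonneg
    · intro hκ
      have := hvπ hκ
      have := hzc hκ
      linarith
    · rw [hve, e2, ← not_le, hingeMd_le_hingeMd_iff sc sz n2 l2 (by linarith) (by linarith)]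
      linarith
  have k1 := hingeMd_add_le e1 hve (modelSin_nonneg dist_nonneg hb.rotate.side)
    (modelSin_nonneg hv0 (hzc.mono hvlt.le))
  rw [add_sub_cancel] at k1
  unfold MetricBetween at hz
  rw [dist_comm c z] at *
  have k2 : modelMd κ (dist b z + v) < modelMd κ (dist b c) :=
    modelMd_lt (by positivity) (by linarith) (h.rotate.side.mono (by linarith))
  have k3 := (hingeMd_le_hingeMd_iff sb sc (comparisonAngle_nonneg κ a b c)
    (comparisonAngle_le_pi κ a b c) Real.pi_pos.le le_rfl).2 (comparisonAngle_le_pi κ a b c)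
  linarith

/-- Part of Alexandrov's lemma: model angles are superadditive. -/
theorem comparisonAngle_add_le (h : SmallTriangle κ a b c) (hz : MetricBetween b z c)
    (ab : a ≠ b) (ac : a ≠ c) (az : a ≠ z) :
    comparisonAngle κ a b z + comparisonAngle κ a c z ≤ comparisonAngle κ a b c := by
  have hb := h.sub hz
  have hc := h.swap.sub hz.symm
  rw [h.le_comparisonAngle_iff ab ac
    (add_nonneg (comparisonAngle_nonneg κ a b z) (comparisonAngle_nonneg κ a c z))
    (comparisonAngle_add_le_pi h hz ab ac az)]
  have k := hingeMd_add_le (hb.eq_hingeMd ab az) (hc.eq_hingeMd ac az)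
    (modelSin_nonneg dist_nonneg hb.rotate.side) (modelSin_nonneg dist_nonneg hc.rotate.side)
  unfold MetricBetween at hz
  rwa [dist_comm c z, hz] at k

/-- With superadditivity the hypothesis becomes an equality, so the two model triangles glued along
`az` form the model triangle of `abc` without a bend at `z`. The side comparison then holds with
equality. -/
theorem sideComparison_of_comparisonAngle_le (h : SmallTriangle κ a b c) (hz : MetricBetween b z c)
    (ab : a ≠ b) (ac : a ≠ c) (az : a ≠ z)
    (hle : comparisonAngle κ a b c ≤ comparisonAngle κ a b z + comparisonAngle κ a c z) :
    SideComparison κ a b c z := by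
  have hb := h.sub hz
  have hc := h.swap.sub hz.symm
  have e := le_antisymm hle (comparisonAngle_add_le h hz ab ac az)
  have e3 := h.eq_hingeMd ab ac
  have e1 := hb.eq_hingeMd ab az
  have e2 := hc.eq_hingeMd ac az
  have hz' : dist b z + dist c z = dist b c := by rw [dist_comm c z]; exact hz
  have k := hingeRadial_add_eq_zero e1 e2 (by rw [← e, hz', e3])
  have r1 := modelSin_mul_hingeRadial κ (dist a b) (dist a z) (comparisonAngle κ a b z)
  have r2 := modelSin_mul_hingeRadial κ (dist a c) (dist a z) (comparisonAngle κ a c z)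
  rw [← e1] at r1
  rw [← e2] at r2
  apply le_of_eq
  rw [dist_comm z c, modelSin_add]
  linear_combination modelSin κ (dist a z) * k - modelSin κ (dist c z) * r1
    - modelSin κ (dist b z) * r2

/-- The four-point comparison implies the comparison for a point on a side of a triangle. -/
theorem sideComparison_of_CATComparison (h : SmallTriangle κ a b c) (hz : MetricBetween b z c)
    (ab : a ≠ b) (ac : a ≠ c) (hC : CATComparison κ z a b c) : SideComparison κ a b c z := by
  rcases eq_or_ne a z with rfl | az
  · simp [SideComparison, dist_comm, modelMd_zero]
  rcases eq_or_ne z b with rfl | zb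
  · simp [SideComparison, modelMd_zero, modelSin_zero]
  rcases eq_or_ne z c with rfl | zc
  · simp [SideComparison, modelMd_zero, modelSin_zero]
  have hb := h.sub hz
  have hc := h.swap.sub hz.symm
  have hzbc : SmallTriangle κ z b c := by
    have hd := h.rotate.side
    unfold MetricBetween at hz
    exact hd.mono (by rw [dist_comm c z, dist_comm z b]; linarith)
  -- The model angle at `z` opposite to `bc` is `π`, so the first alternative bounds the angle sum
  -- at `z` from below; the second is the reverse of Alexandrov's superadditivity at `a`.
  rcases hC with hC | hC | hC
  · rw [hz.comparisonAngle_eq_pi hzbc zb zc] at hC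
    exact ((hb.rotate.rotate).pi_le_add_iff hc.rotate.rotate az.symm zb zc).1 hC
  · rw [hb.swap.comparisonAngle_comm az ab, hc.swap.comparisonAngle_comm az ac] at hC
    exact sideComparison_of_comparisonAngle_le h hz ab ac az hC
  · exact absurd ⟨comparisonAngleDefined_iff.2 ⟨zb, zc, hzbc⟩,
      comparisonAngleDefined_iff.2 ⟨az.symm, zb, hb.rotate.rotate⟩,
      comparisonAngleDefined_iff.2 ⟨az.symm, zc, hc.rotate.rotate⟩,
      comparisonAngleDefined_iff.2 ⟨ab, ac, h⟩,
      comparisonAngleDefined_iff.2 ⟨az, ab, hb.swap⟩,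
      comparisonAngleDefined_iff.2 ⟨az, ac, hc.swap⟩⟩ hC

end Triangles

/-! ### Stability of division points in a `CAT(κ)` space. -/

section Geodesics

variable {X : Type*} [MetricSpace X] {κ : ℝ}

theorem BelowVarpi.eventually {ι : Type*} {l : Filter ι} {f : ι → ℝ} {t : ℝ}
    (h : BelowVarpi κ t) (hf : Filter.Tendsto f l (𝓝 t)) : ∀ᶠ i in l, BelowVarpi κ (f i) := by
  by_cases hκ : 0 < κ
  · filter_upwards [(hf.const_mul (Real.sqrt κ)).eventually_lt_const (h hκ)] with i hi _
    exact hi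
  · exact Filter.Eventually.of_forall fun i h => absurd h hκ

theorem cos_add_cos_le {ω ζ₁ ζ₂ : ℝ} (h : ω ≤ ζ₁ + ζ₂) (h0 : 0 ≤ ω) (hω : ω ≤ Real.pi)
    (h1 : 0 ≤ ζ₁) (h1' : ζ₁ ≤ Real.pi) (h2 : 0 ≤ ζ₂) (h2' : ζ₂ ≤ Real.pi) :
    Real.cos ζ₁ + Real.cos ζ₂ ≤ 2 * Real.cos (ω / 2) := by
  rw [Real.cos_add_cos]
  have a1 : Real.cos ((ζ₁ + ζ₂) / 2) ≤ Real.cos (ω / 2) :=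
    Real.cos_le_cos_of_nonneg_of_le_pi (by linarith) (by linarith) (by linarith)
  have a2 : 0 ≤ Real.cos (ω / 2) :=
    Real.cos_nonneg_of_neg_pi_div_two_le_of_le (by linarith) (by linarith)
  have a3 : 0 ≤ Real.cos ((ζ₁ - ζ₂) / 2) :=
    Real.cos_nonneg_of_neg_pi_div_two_le_of_le (by linarith) (by linarith)
  have a4 := Real.cos_le_one ((ζ₁ - ζ₂) / 2)
  nlinarith [mul_le_mul_of_nonneg_right a1 a3, mul_le_mul_of_nonneg_left a4 a2]

/-- If `m` divides the pair `x`, `y` approximately like `m'`, and the model angles at `m` satisfy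
the triangle inequality, then `m` is close to `m'`. -/
theorem modelMd_mul_le_of_comparisonAngle_le {x y m m' : X} (hx : SmallTriangle κ m m' x)
    (hy : SmallTriangle κ m m' y) (hxy : SmallTriangle κ m x y) (mm : m ≠ m') (mx : m ≠ x)
    (my : m ≠ y)
    (h : comparisonAngle κ m x y ≤ comparisonAngle κ m m' x + comparisonAngle κ m m' y) :
    modelMd κ (dist m m') * modelSin κ (dist m x + dist m y) ≤
      modelSin κ (dist m m') * Real.sqrt (2 * (modelSin κ (dist m x) * modelSin κ (dist m y)) *
        (modelMd κ (dist m x + dist m y) - modelMd κ (dist x y)))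
      + modelSin κ (dist m y) * |modelMd κ (dist m' x) - modelMd κ (dist m x)|
      + modelSin κ (dist m x) * |modelMd κ (dist m' y) - modelMd κ (dist m y)| := by
  have e1 := hx.eq_hingeMd mm mx
  have e2 := hy.eq_hingeMd mm my
  have e3 := hxy.eq_hingeMd mx my
  have sd := hx.modelSin_pos mm
  have su := hx.swap.modelSin_pos mx
  have sv := hy.swap.modelSin_pos my
  have hcos := cos_add_cos_le h (comparisonAngle_nonneg _ _ _ _) (comparisonAngle_le_pi _ _ _ _)
    (comparisonAngle_nonneg _ _ _ _) (comparisonAngle_le_pi _ _ _ _)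
    (comparisonAngle_nonneg _ _ _ _) (comparisonAngle_le_pi _ _ _ _)
  have n0 := comparisonAngle_nonneg κ m x y
  have l0 := comparisonAngle_le_pi κ m x y
  set ω := comparisonAngle κ m x y
  have hc0 : 0 ≤ Real.cos (ω / 2) :=
    Real.cos_nonneg_of_neg_pi_div_two_le_of_le (by linarith) (by linarith)
  -- The excess `modelMd (|mx| + |my|) - modelMd |xy|` is the product of the two sines times `1 +
  -- cos ω = 2 cos² (ω / 2)`.
  have hη : modelSin κ (dist m x) * modelSin κ (dist m y) * (2 * Real.cos (ω / 2)) =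
      Real.sqrt (2 * (modelSin κ (dist m x) * modelSin κ (dist m y)) *
        (modelMd κ (dist m x + dist m y) - modelMd κ (dist x y))) := by
    have hω : Real.cos ω = 2 * Real.cos (ω / 2) ^ 2 - 1 := by
      rw [← Real.cos_two_mul, mul_div_cancel₀ _ two_ne_zero]
    rw [← Real.sqrt_sq (by positivity : 0 ≤ modelSin κ (dist m x) * modelSin κ (dist m y)
      * (2 * Real.cos (ω / 2)))]
    congr 1
    rw [e3, modelMd_add, hingeMd, hω]
    ring
  have a1 := mul_le_mul_of_nonneg_left (le_abs_self
    (modelMd κ (dist m' x) - modelMd κ (dist m x))) sv.le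
  have a2 := mul_le_mul_of_nonneg_left (le_abs_self
    (modelMd κ (dist m' y) - modelMd κ (dist m y))) su.le
  have a3 := mul_le_mul_of_nonneg_left hcos (mul_pos sd (mul_pos su sv)).le
  rw [← hη, modelSin_add]
  unfold hingeMd at e1 e2
  nlinarith

/-- Two approximate division points of a pair of points, with the same approximate distances to
its ends, are close to each other. -/
theorem IsCAT.tendsto_dist_zero (hX : IsCAT κ X) {ι : Type*} {l : Filter ι} {x y m m' : ι → X}
    {s t : ℝ} (hs : 0 ≤ s) (ht : 0 ≤ t) (hst : BelowVarpi κ (s + t))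
    (hxy : Filter.Tendsto (fun i => dist (x i) (y i)) l (𝓝 (s + t)))
    (hmx : Filter.Tendsto (fun i => dist (m i) (x i)) l (𝓝 s))
    (hmy : Filter.Tendsto (fun i => dist (m i) (y i)) l (𝓝 t))
    (hmx' : Filter.Tendsto (fun i => dist (m' i) (x i)) l (𝓝 s))
    (hmy' : Filter.Tendsto (fun i => dist (m' i) (y i)) l (𝓝 t)) :
    Filter.Tendsto (fun i => dist (m i) (m' i)) l (𝓝 0) := by
  have hdx : ∀ i, dist (m i) (m' i) ≤ dist (m i) (x i) + dist (m' i) (x i) :=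
    fun i => dist_triangle_right _ _ _
  have hdy : ∀ i, dist (m i) (m' i) ≤ dist (m i) (y i) + dist (m' i) (y i) :=
    fun i => dist_triangle_right _ _ _
  rcases hs.eq_or_lt with rfl | hs
  · exact squeeze_zero (fun _ => dist_nonneg) hdx (by simpa using hmx.add hmx')
  rcases ht.eq_or_lt with rfl | ht
  · exact squeeze_zero (fun _ => dist_nonneg) hdy (by simpa using hmy.add hmy')
  -- `K` bounds `modelSin |m m'|`: eventually `|m m'| ≤ 2 s + 1`, by the triangle inequality through
  -- `x`.
  obtain ⟨K, hK⟩ := (isCompact_Icc (a := (0 : ℝ)) (b := 2 * s + 1)).bddAbove_image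
    (continuous_modelSin κ).continuousOn
  have hK0 : 0 ≤ K := by
    rw [← modelSin_zero κ]
    exact hK ⟨0, ⟨le_rfl, by linarith⟩, rfl⟩
  let E : ℝ → ℝ → ℝ → ℝ → ℝ → ℝ := fun u v u' v' L =>
    (K * Real.sqrt (2 * (modelSin κ u * modelSin κ v) * (modelMd κ (u + v) - modelMd κ L))
      + modelSin κ v * |modelMd κ u' - modelMd κ u|
      + modelSin κ u * |modelMd κ v' - modelMd κ v|) / modelSin κ (u + v)
  have sst : 0 < modelSin κ (s + t) := modelSin_pos (by linarith) hst
  have hE : ∀ {u v u' v' L : ι → ℝ}, Filter.Tendsto u l (𝓝 s) → Filter.Tendsto v l (𝓝 t) →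
      Filter.Tendsto u' l (𝓝 s) → Filter.Tendsto v' l (𝓝 t) →
      Filter.Tendsto L l (𝓝 (s + t)) →
      Filter.Tendsto (fun i => E (u i) (v i) (u' i) (v' i) (L i)) l (𝓝 0) := by
    intro u v u' v' L hu hv hu' hv' hL
    have S : ∀ {f : ι → ℝ} {a : ℝ}, Filter.Tendsto f l (𝓝 a) →
        Filter.Tendsto (fun i => modelSin κ (f i)) l (𝓝 (modelSin κ a)) :=
      fun hf => ((continuous_modelSin κ).tendsto _).comp hf
    have M : ∀ {f : ι → ℝ} {a : ℝ}, Filter.Tendsto f l (𝓝 a) →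
        Filter.Tendsto (fun i => modelMd κ (f i)) l (𝓝 (modelMd κ a)) :=
      fun hf => ((continuous_modelMd κ).tendsto _).comp hf
    have h := (((((((S hu).mul (S hv)).const_mul 2).mul ((M (hu.add hv)).sub (M hL))).sqrt.const_mul
      K).add ((S hv).mul ((M hu').sub (M hu)).abs)).add
      ((S hu).mul ((M hv').sub (M hv)).abs)).div (S (hu.add hv)) sst.ne'
    have e : (K * Real.sqrt (2 * (modelSin κ s * modelSin κ t)
        * (modelMd κ (s + t) - modelMd κ (s + t)))
        + modelSin κ t * |modelMd κ s - modelMd κ s|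
        + modelSin κ s * |modelMd κ t - modelMd κ t|) / modelSin κ (s + t) = 0 := by simp
    rw [e] at h
    exact h
  have E1 := hE hmx hmy hmx' hmy' hxy
  have E2 := hE hmx' hmy' hmx hmy hxy
  -- A maximum of the two bounds is needed because the alternative that holds in the four-point
  -- comparison may change with `i`.
  have key : ∀ᶠ i in l, modelMd κ (dist (m i) (m' i)) ≤
      max (E (dist (m i) (x i)) (dist (m i) (y i)) (dist (m' i) (x i)) (dist (m' i) (y i))
        (dist (x i) (y i)))
      (E (dist (m' i) (x i)) (dist (m' i) (y i)) (dist (m i) (x i)) (dist (m i) (y i))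
        (dist (x i) (y i))) := by
    have b1 : BelowVarpi κ ((s + t + s + t) / 2) := by convert hst using 1; ring
    have b2 : BelowVarpi κ ((s + t + (s + t)) / 2) := by convert hst using 1; ring
    filter_upwards [b1.eventually ((((hmx.add hmy).add hmx').add hmy').div_const 2),
      b2.eventually (((hmx.add hmy).add hxy).div_const 2),
      b2.eventually (((hmx'.add hmy').add hxy).div_const 2),
      hst.eventually (hmx.add hmy), hst.eventually (hmx'.add hmy'),
      hmx.eventually_const_lt hs, hmy.eventually_const_lt ht, hmx'.eventually_const_lt hs,
      hmy'.eventually_const_lt ht,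
      (hmx.add hmx').eventually_lt_const (by linarith : s + s < 2 * s + 1)]
      with i c1 c2 c2' c3 c3' p1 p2 p3 p4 c4
    have hd := hdx i
    have hd' := hdy i
    have sdK : modelSin κ (dist (m i) (m' i)) ≤ K :=
      hK ⟨_, ⟨dist_nonneg, by linarith⟩, rfl⟩
    have s1 : 0 < modelSin κ (dist (m i) (x i) + dist (m i) (y i)) :=
      modelSin_pos (by linarith) c3
    have s2 : 0 < modelSin κ (dist (m' i) (x i) + dist (m' i) (y i)) :=
      modelSin_pos (by linarith) c3'
    rw [le_max_iff]
    simp only [E]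
    rw [le_div_iff₀ s1, le_div_iff₀ s2]
    rcases eq_or_ne (m i) (m' i) with e | mm
    · left
      have := modelSin_pos p1 (c3.mono (by linarith))
      have := modelSin_pos p2 (c3.mono (by linarith))
      rw [e, dist_self, modelMd_zero, zero_mul]
      rw [e] at *
      positivity
    · have mx := dist_pos.1 p1
      have my := dist_pos.1 p2
      have mx' := dist_pos.1 p3
      have my' := dist_pos.1 p4
      have t1 : SmallTriangle κ (m i) (m' i) (x i) := c1.mono (by
        rw [dist_comm (x i)]; linarith)
      have t2 : SmallTriangle κ (m i) (m' i) (y i) := c1.mono (by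
        rw [dist_comm (y i)]; linarith)
      have t3 : SmallTriangle κ (m i) (x i) (y i) := c2.mono (by
        rw [dist_comm (y i) (m i)]; linarith)
      have t4 : SmallTriangle κ (m' i) (x i) (y i) := c2'.mono (by
        rw [dist_comm (y i) (m' i)]; linarith)
      rcases hX (m i) (m' i) (x i) (y i) with h | h | h
      · left
        refine (modelMd_mul_le_of_comparisonAngle_le t1 t2 t3 mm mx my h).trans ?_
        gcongr
      · right
        have := modelMd_mul_le_of_comparisonAngle_le t1.swap.rotate.rotate t2.swap.rotate.rotate
          t4 mm.symm mx' my' h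
        rw [dist_comm (m' i) (m i)] at this
        refine this.trans ?_
        gcongr
      · refine absurd ⟨comparisonAngleDefined_iff.2 ⟨mx, my, t3⟩,
          comparisonAngleDefined_iff.2 ⟨mm, mx, t1⟩,
          comparisonAngleDefined_iff.2 ⟨mm, my, t2⟩,
          comparisonAngleDefined_iff.2 ⟨mx', my', t4⟩,
          comparisonAngleDefined_iff.2 ⟨mm.symm, mx', t1.swap.rotate.rotate⟩,
          comparisonAngleDefined_iff.2 ⟨mm.symm, my', t2.swap.rotate.rotate⟩⟩ h
  have hmd : Filter.Tendsto (fun i => modelMd κ (dist (m i) (m' i))) l (𝓝 0) := by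
    have := E1.max E2
    rw [max_self] at this
    exact tendsto_of_tendsto_of_tendsto_of_le_of_le' tendsto_const_nhds this
      (Filter.Eventually.of_forall fun _ => modelMd_nonneg) key
  -- For `κ > 0`, `modelMd` is also small near `2 ϖκ`, so its decay alone is not enough. Averaging
  -- the bounds through `x` and `y` keeps `|m m'|` asymptotically at most `s + t`, which is below
  -- `ϖκ`.
  rw [Metric.tendsto_nhds]
  intro ε hε
  have hδ : 0 < min ε (s + t) := lt_min hε (by linarith)
  have b1 : BelowVarpi κ ((s + t + s + t + 2 * (s + t)) / 4) := by convert hst using 1; ring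
  have hpos : 0 < modelMd κ (min ε (s + t)) := by
    have := modelMd_lt (κ := κ) le_rfl hδ (hst.mono (by
      have := min_le_right ε (s + t); linarith))
    rwa [modelMd_zero] at this
  filter_upwards [Metric.tendsto_nhds.1 hmd _ hpos,
    b1.eventually (((((hmx.add hmy).add hmx').add hmy').add_const _).div_const 4)] with i hi hb
  rw [Real.dist_eq, sub_zero, abs_of_nonneg modelMd_nonneg] at hi
  rw [Real.dist_eq, sub_zero, abs_of_nonneg dist_nonneg]
  refine (lt_of_modelMd_lt hδ.le (hb.mono ?_) hi).trans_le (min_le_left _ _)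
  linarith [hdx i, hdy i, min_le_right ε (s + t)]

end Geodesics

/-! ### Existence, uniqueness and continuity of geodesics. -/

section Existence

variable {X : Type*} [MetricSpace X] {κ : ℝ}

/-- On an almost shortest path some point has distance exactly `s` from `x`, by the intermediate
value theorem; additivity of length bounds what remains. -/
theorem IsLengthSpace.exists_approx (hX : IsLengthSpace X) (x y : X) {s t ε : ℝ} (hs : 0 ≤ s)
    (ht : 0 ≤ t) (hst : s + t = dist x y) (hε : 0 < ε) :
    ∃ m, dist m x = s ∧ dist m y < t + ε := by
  have h : ⨅ γ : Path x y, eVariationOn γ Set.univ < ENNReal.ofReal (dist x y + ε) := by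
    rw [hX x y, edist_dist]
    exact (ENNReal.ofReal_lt_ofReal_iff (by positivity)).2 (by linarith)
  obtain ⟨γ, hγ⟩ := iInf_lt_iff.1 h
  have hc : Continuous fun u => dist (γ u) x := by fun_prop
  obtain ⟨u, hu⟩ := intermediate_value_univ 0 1 hc (show s ∈ Set.Icc _ _ by
    simp only [γ.source, γ.target, dist_self, dist_comm y x, Set.mem_Icc]
    constructor <;> linarith)
  simp only at hu
  refine ⟨γ u, hu, ?_⟩
  have h1 := eVariationOn.edist_le γ (s := Set.Iic u) (x := u) (y := 0) (by simp)
    (Set.mem_Iic.2 u.2.1)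
  have h2 := eVariationOn.edist_le γ (s := Set.Ici u) (x := u) (y := 1) (by simp)
    (Set.mem_Ici.2 u.2.2)
  have h3 := eVariationOn.add_le_union γ (s := Set.Iic u) (t := Set.Ici u)
    (fun a ha b hb => le_trans ha hb)
  rw [Set.Iic_union_Ici] at h3
  have h4 := (((add_le_add h1 h2).trans h3).trans_lt hγ)
  rw [γ.source, γ.target, edist_dist, edist_dist, ← ENNReal.ofReal_add dist_nonneg dist_nonneg,
    ENNReal.ofReal_lt_ofReal_iff (by positivity)] at h4
  linarith

theorem IsCAT.eq_of_dist_eq (hX : IsCAT κ X) {x y m m' : X} (hxy : BelowVarpi κ (dist x y))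
    (hm : dist m x + dist m y = dist x y) (hx : dist m' x = dist m x)
    (hy : dist m' y = dist m y) : m = m' := by
  have h := hX.tendsto_dist_zero (l := (Filter.atTop : Filter ℕ)) (x := fun _ => x)
    (y := fun _ => y) (m := fun _ => m) (m' := fun _ => m') (s := dist m x) (t := dist m y)
    dist_nonneg dist_nonneg (hm ▸ hxy) (hm ▸ tendsto_const_nhds) tendsto_const_nhds
    tendsto_const_nhds (hx ▸ tendsto_const_nhds) (hy ▸ tendsto_const_nhds)
  exact dist_eq_zero.1 (tendsto_nhds_unique tendsto_const_nhds h)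

theorem IsCAT.exists_dist_eq [CompleteSpace X] (hX : IsCAT κ X) (hL : IsLengthSpace X)
    {x y : X} (hxy : BelowVarpi κ (dist x y)) {s t : ℝ} (hs : 0 ≤ s) (ht : 0 ≤ t)
    (hst : s + t = dist x y) : ∃ m, dist m x = s ∧ dist m y = t := by
  choose m hmx hmy using fun n : ℕ =>
    hL.exists_approx x y hs ht hst (Nat.one_div_pos_of_nat (α := ℝ) (n := n))
  have hx : Filter.Tendsto (fun n => dist (m n) x) Filter.atTop (𝓝 s) := by
    simp_rw [hmx]; exact tendsto_const_nhds
  have hy : Filter.Tendsto (fun n => dist (m n) y) Filter.atTop (𝓝 t) := by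
    refine tendsto_of_tendsto_of_tendsto_of_le_of_le (tendsto_const_nhds (x := t))
      (by simpa using tendsto_one_div_add_atTop_nhds_zero_nat.const_add t) (fun n => ?_)
      (fun n => (hmy n).le)
    have := dist_triangle_left x y (m n)
    rw [hmx] at this
    linarith
  have hc : CauchySeq m := by
    rw [cauchySeq_iff_tendsto_dist_atTop_0, ← Filter.prod_atTop_atTop_eq]
    exact hX.tendsto_dist_zero (x := fun _ => x) (y := fun _ => y) hs ht (hst ▸ hxy)
      (hst ▸ tendsto_const_nhds) (hx.comp Filter.tendsto_fst) (hy.comp Filter.tendsto_fst)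
      (hx.comp Filter.tendsto_snd) (hy.comp Filter.tendsto_snd)
  obtain ⟨p, hp⟩ := cauchySeq_tendsto_of_complete hc
  exact ⟨p, tendsto_nhds_unique (hp.dist tendsto_const_nhds) hx,
    tendsto_nhds_unique (hp.dist tendsto_const_nhds) hy⟩

theorem IsGeodesicPath.dist_left {γ : unitInterval → X} {x y : X} (h : IsGeodesicPath γ x y)
    (t : unitInterval) : dist (γ t) x = t * dist x y := by
  have h2 := h.2.2 t 0
  rw [h.1] at h2
  simpa [abs_of_nonneg t.2.1] using h2

theorem IsGeodesicPath.dist_right {γ : unitInterval → X} {x y : X} (h : IsGeodesicPath γ x y)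
    (t : unitInterval) : dist (γ t) y = (1 - t) * dist x y := by
  have h2 := h.2.2 t 1
  rw [h.2.1] at h2
  have h3 : |(t : ℝ) - 1| = 1 - t := by
    rw [abs_sub_comm]; exact abs_of_nonneg (sub_nonneg.2 t.2.2)
  simpa [h3] using h2

theorem IsCAT.geodesicPath_unique (hX : IsCAT κ X) {x y : X} (hxy : BelowVarpi κ (dist x y))
    {γ γ' : unitInterval → X} (h : IsGeodesicPath γ x y) (h' : IsGeodesicPath γ' x y) :
    γ = γ' := by
  ext t
  apply hX.eq_of_dist_eq hxy
  · rw [h.dist_left, h.dist_right]; ring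
  · rw [h.dist_left, h'.dist_left]
  · rw [h.dist_right, h'.dist_right]

theorem IsCAT.exists_geodesicPath [CompleteSpace X] (hX : IsCAT κ X) (hL : IsLengthSpace X)
    {x y : X} (hxy : BelowVarpi κ (dist x y)) :
    ∃ γ : unitInterval → X, IsGeodesicPath γ x y := by
  choose γ h1 h2 using fun t : unitInterval => hX.exists_dist_eq hL hxy
    (mul_nonneg t.2.1 dist_nonneg) (mul_nonneg (sub_nonneg.2 t.2.2) dist_nonneg)
    (by ring : (t : ℝ) * dist x y + (1 - t) * dist x y = dist x y)
  have key : ∀ s t : unitInterval, s ≤ t → dist (γ s) (γ t) = (t - s) * dist x y := by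
    intro s t hst
    have hst' : (s : ℝ) ≤ t := hst
    rcases t.2.1.eq_or_lt with h0 | h0
    · have : s = t := le_antisymm hst (by rw [Subtype.mk_le_mk, ← h0]; exact s.2.1)
      simp [this]
    have hxt : dist x (γ t) ≤ dist x y := by
      rw [dist_comm x (γ t), h1]
      exact mul_le_of_le_one_left dist_nonneg t.2.2
    -- The division points are chosen separately for each parameter. Here `γ s` is recovered as a
    -- division point of the shorter pair `x`, `γ t`, and uniqueness identifies the two, which gives
    -- the distance from `γ s` to `γ t`.
    obtain ⟨w, w1, w2⟩ := hX.exists_dist_eq hL (hxy.mono hxt) (s := s * dist x y)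
      (t := (t - s) * dist x y) (mul_nonneg s.2.1 dist_nonneg)
      (mul_nonneg (sub_nonneg.2 hst') dist_nonneg) (by rw [dist_comm x (γ t), h1]; ring)
    have w3 : dist w y = (1 - s) * dist x y := by
      apply le_antisymm
      · have := dist_triangle w (γ t) y
        rw [w2, h2] at this
        linarith
      · have := dist_triangle_left x y w
        rw [w1] at this
        linarith
    have e : γ s = w := hX.eq_of_dist_eq hxy (by rw [h1, h2]; ring) (by rw [w1, h1])
      (by rw [w3, h2])
    rw [e, w2]
  refine ⟨γ, ?_, ?_, fun s t => ?_⟩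
  · have := h1 0
    simpa using this
  · have := h2 1
    simpa using this
  · rcases le_total s t with hst | hst
    · rw [key s t hst, abs_sub_comm, abs_of_nonneg (sub_nonneg.2 (Subtype.coe_le_coe.2 hst))]
    · rw [dist_comm, key t s hst, abs_of_nonneg (sub_nonneg.2 (Subtype.coe_le_coe.2 hst))]

theorem IsCAT.uniquelyGeodesicBelow [CompleteSpace X] (hX : IsCAT κ X) (hL : IsLengthSpace X) :
    UniquelyGeodesicBelow (varpi κ) X := by
  intro x y h
  rw [edist_lt_varpi] at h
  obtain ⟨γ, hγ⟩ := hX.exists_geodesicPath hL h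
  exact ⟨γ, hγ, fun γ' h' => hX.geodesicPath_unique h h' hγ⟩

theorem IsCAT.geodesicsContinuousBelow [CompleteSpace X] (hX : IsCAT κ X)
    (hL : IsLengthSpace X) : GeodesicsContinuousBelow (varpi κ) X := by
  choose G hG using fun p : {p : X × X // edist p.1 p.2 < varpi κ} =>
    hX.exists_geodesicPath hL (edist_lt_varpi.1 p.2)
  have hc : Continuous fun q : {p : X × X // edist p.1 p.2 < varpi κ} × unitInterval =>
      G q.1 q.2 := by
    rw [continuous_iff_continuousAt]
    intro q₀
    rw [ContinuousAt, tendsto_iff_dist_tendsto_zero]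
    have c : ∀ {f : {p : X × X // edist p.1 p.2 < varpi κ} × unitInterval → ℝ},
        Continuous f → Filter.Tendsto f (𝓝 q₀) (𝓝 (f q₀)) := fun hf => hf.tendsto _
    have hq := edist_lt_varpi.1 q₀.1.2
    have e : (q₀.2 : ℝ) * dist q₀.1.1.1 q₀.1.1.2 + (1 - q₀.2) * dist q₀.1.1.1 q₀.1.1.2
        = dist q₀.1.1.1 q₀.1.1.2 := by ring
    -- The moving point of the moving geodesic is compared with the fixed point of the limit
    -- geodesic; their distances to the moving ends have the same limits. Currying the resulting
    -- jointly continuous map gives continuity into the path space.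
    refine hX.tendsto_dist_zero (x := fun q => q.1.1.1) (y := fun q => q.1.1.2)
      (s := q₀.2 * dist q₀.1.1.1 q₀.1.1.2) (t := (1 - q₀.2) * dist q₀.1.1.1 q₀.1.1.2)
      (mul_nonneg q₀.2.2.1 dist_nonneg) (mul_nonneg (sub_nonneg.2 q₀.2.2.2) dist_nonneg)
      (by rw [e]; exact hq) ?_ ?_ ?_ ?_ ?_
    · rw [e]; exact c (by fun_prop)
    · simp_rw [(hG _).dist_left]
      exact c (f := fun q => q.2 * dist q.1.1.1 q.1.1.2) (by fun_prop)
    · simp_rw [(hG _).dist_right]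
      exact c (f := fun q => (1 - q.2) * dist q.1.1.1 q.1.1.2) (by fun_prop)
    · rw [← (hG _).dist_left]
      exact c (f := fun q => dist (G q₀.1 q₀.2) q.1.1.1) (by fun_prop)
    · rw [← (hG _).dist_right]
      exact c (f := fun q => dist (G q₀.1 q₀.2) q.1.1.2) (by fun_prop)
  let F : C({p : X × X // edist p.1 p.2 < varpi κ} × unitInterval, X) := ⟨_, hc⟩
  exact ⟨F.curry, fun p => hG p, F.curry.continuous⟩

end Existence

/-! ### Upper angles, good triangles and the inheritance lemma. -/

section Angles

variable {X : Type*} [MetricSpace X] {κ : ℝ} {a b c p q x y z : X}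

/-- Points at distance less than `ϖκ` are joined by a unique geodesic, in terms of the points
lying between them. -/
structure UniqueBetween (κ : ℝ) (X : Type*) [MetricSpace X] : Prop where
  exists_between : ∀ {b c : X}, BelowVarpi κ (dist b c) → ∀ {r : ℝ}, 0 ≤ r → r ≤ dist b c →
    ∃ z, MetricBetween b z c ∧ dist b z = r
  unique : ∀ {b c z z' : X}, BelowVarpi κ (dist b c) → MetricBetween b z c →
    MetricBetween b z' c → dist b z = dist b z' → z = z'

theorem MetricBetween.dist_le (h : MetricBetween b z c) : dist b z ≤ dist b c := by
  unfold MetricBetween at h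
  linarith [dist_nonneg (x := z) (y := c)]

theorem UniqueBetween.between_of_le (hU : UniqueBetween κ X) (hbc : BelowVarpi κ (dist b c))
    (hz : MetricBetween b z c) (hx : MetricBetween b x c) (hle : dist b x ≤ dist b z) :
    MetricBetween b x z := by
  obtain ⟨w, hw, hwe⟩ := hU.exists_between (hbc.mono hz.dist_le) dist_nonneg hle
  rwa [← hU.unique hbc (hz.trans hw).1 hx hwe]

theorem exists_pos_belowVarpi (κ : ℝ) : ∃ ρ > 0, BelowVarpi κ ρ := by
  by_cases hκ : 0 < κ
  · have hs : 0 < Real.sqrt κ := Real.sqrt_pos.2 hκ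
    refine ⟨1 / Real.sqrt κ, by positivity, fun _ => ?_⟩
    rw [mul_one_div_cancel hs.ne']
    linarith [Real.pi_gt_three]
  · exact ⟨1, one_pos, fun h => absurd h hκ⟩

theorem BelowVarpi.avg {s t : ℝ} (hs : BelowVarpi κ s) (ht : BelowVarpi κ t) :
    BelowVarpi κ ((s + t) / 2) := fun hκ => by linarith [hs hκ, ht hκ]

theorem modelCos_nonneg {t : ℝ} (ht : 0 ≤ t) (h : BelowVarpi κ (2 * t)) :
    0 ≤ 1 - κ * modelMd κ t := by
  rw [← modelCos_eq, modelCos]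
  split_ifs with h0
  · have := h h0
    have : 0 ≤ Real.sqrt κ * t := by positivity
    exact Real.cos_nonneg_of_neg_pi_div_two_le_of_le (by linarith [Real.pi_pos]) (by linarith)
  · exact zero_le_one
  · exact (Real.cosh_pos _).le

/-- The upper angle at `p` between the geodesics from `p` to `x` and from `p` to `y` is at
most `θ`. -/
def AngleLE (κ : ℝ) (p x y : X) (θ : ℝ) : Prop :=
  ∀ ε > 0, ∃ ρ > 0, ∀ x' y', p ≠ x' → p ≠ y' → MetricBetween p x' x → MetricBetween p y' y →
    dist p x' < ρ → dist p y' < ρ → comparisonAngle κ p x' y' ≤ θ + ε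

theorem AngleLE.mono {θ θ' : ℝ} (h : AngleLE κ p x y θ) (hθ : θ ≤ θ') :
    AngleLE κ p x y θ' := by
  intro ε hε
  obtain ⟨ρ, hρ, H⟩ := h ε hε
  exact ⟨ρ, hρ, fun x' y' h1 h2 h3 h4 h5 h6 => (H x' y' h1 h2 h3 h4 h5 h6).trans (by linarith)⟩

theorem smallTriangle_of_dist_lt {ρ : ℝ} (hρ : BelowVarpi κ (2 * ρ)) (hx : dist p x < ρ)
    (hy : dist p y < ρ) : SmallTriangle κ p x y :=
  hρ.mono (by
    have := dist_triangle_left x y p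
    rw [dist_comm y p]
    linarith)

theorem exists_pos_belowVarpi_two_mul (κ : ℝ) : ∃ ρ > 0, BelowVarpi κ (2 * ρ) := by
  obtain ⟨ρ, hρ, h⟩ := exists_pos_belowVarpi κ
  exact ⟨ρ / 2, by positivity, h.mono (by linarith)⟩

theorem AngleLE.symm {θ : ℝ} (h : AngleLE κ p x y θ) : AngleLE κ p y x θ := by
  intro ε hε
  obtain ⟨ρ, hρ, H⟩ := h ε hε
  obtain ⟨ρ', hρ', h'⟩ := exists_pos_belowVarpi_two_mul κ
  refine ⟨min ρ ρ', lt_min hρ hρ', fun x' y' h1 h2 h3 h4 h5 h6 => ?_⟩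
  rw [lt_min_iff] at h5 h6
  rw [(smallTriangle_of_dist_lt h' h5.2 h6.2).comparisonAngle_comm h1 h2]
  exact H y' x' h2 h1 h4 h3 h6.1 h5.1

/-- The expression is at least `modelSin (R - |px|)`, because the cosine of `R` is nonnegative: from
a point at least as far from the vertex, the angle is not obtuse. This supplies the sign condition
of `exists_crossing`. -/
theorem hingeRadial_nonneg {R α : ℝ} (hb : 0 ≤ dist p x) (hR : dist p x ≤ R)
    (h : BelowVarpi κ (2 * R)) : 0 ≤ hingeRadial κ (dist p x) R α := by
  have h1 := modelCos_nonneg (hb.trans hR) h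
  have h2 := modelSin_nonneg hb (h.mono (by linarith))
  have h3 := modelSin_nonneg (sub_nonneg.2 hR) (h.mono (by linarith))
  rw [modelSin_sub] at h3
  unfold hingeRadial
  nlinarith [mul_nonneg h2 h1, Real.cos_le_one α]

/-- The triangle inequality for upper angles. -/
theorem AngleLE.add (hU : UniqueBetween κ X) {α β : ℝ} (hz : p ≠ z)
    (hpz : BelowVarpi κ (dist p z)) (hα : 0 ≤ α) (hβ : 0 ≤ β) (h1 : AngleLE κ p x z α)
    (h2 : AngleLE κ p z y β) : AngleLE κ p x y (α + β) := by
  intro ε hε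
  by_cases hπ : Real.pi ≤ α + β + ε
  · exact ⟨1, one_pos, fun _ _ _ _ _ _ _ _ => (comparisonAngle_le_pi _ _ _ _).trans hπ⟩
  push Not at hπ
  obtain ⟨ρ₁, hρ₁, H1⟩ := h1 (ε / 2) (by positivity)
  obtain ⟨ρ₂, hρ₂, H2⟩ := h2 (ε / 2) (by positivity)
  obtain ⟨ρ₃, hρ₃, h3⟩ := exists_pos_belowVarpi_two_mul κ
  refine ⟨min (min ρ₁ ρ₂) (min ρ₃ (dist p z)),
    lt_min (lt_min hρ₁ hρ₂) (lt_min hρ₃ (dist_pos.2 hz)), fun x' y' nx ny bx by' dx dy => ?_⟩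
  have hR := max_lt dx dy
  simp only [lt_min_iff] at hR dx dy
  have hR2 : BelowVarpi κ (2 * max (dist p x') (dist p y')) := h3.mono (by linarith [hR.2.1])
  have hx0 := dist_pos.2 nx
  have hy0 := dist_pos.2 ny
  have hR0 : 0 ≤ max (dist p x') (dist p y') := hx0.le.trans (le_max_left _ _)
  have txy := smallTriangle_of_dist_lt h3 dx.2.1 dy.2.1
  have sx := txy.modelSin_pos nx
  have sy := txy.swap.modelSin_pos ny
  have hs1 : 0 ≤ Real.sin (α + ε / 2) :=
    Real.sin_nonneg_of_nonneg_of_le_pi (by linarith) (by linarith)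
  have hs2 : 0 ≤ Real.sin (β + ε / 2) :=
    Real.sin_nonneg_of_nonneg_of_le_pi (by linarith) (by linarith)
  have hr1 := hingeRadial_nonneg (α := α + ε / 2) dist_nonneg (le_max_left _ _) hR2
  have hr2 := hingeRadial_nonneg (α := β + ε / 2) dist_nonneg (le_max_right _ _) hR2
  -- Two model hinges with slightly enlarged, hence positive, angles are placed side by side; `R` is
  -- the longer outer side. Their crossing determines a point `z'` of the geodesic `pz`, and the
  -- path through `z'` bounds `|x'y'|` by the model segment.
  obtain ⟨r, u, v, r0, rR, u0, v0, huv, hu, hv, hw⟩ := exists_crossing (κ := κ)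
    (R := max (dist p x') (dist p y')) (α := α + ε / 2) (β := β + ε / 2) hx0 hy0 hR0 txy.side
    txy.swap.side (hR2.mono (by linarith)) (by linarith) (by linarith) (by linarith)
    (by positivity)
  obtain ⟨z', bz, hz'⟩ := hU.exists_between hpz r0.le (rR.trans hR.2.2.le)
  subst hz'
  have nz : p ≠ z' := dist_pos.1 r0
  have dz := rR.trans_lt hR.2.1
  have txz := smallTriangle_of_dist_lt h3 dx.2.1 dz
  have tyz := smallTriangle_of_dist_lt h3 dy.2.1 dz
  have k1 := H1 x' z' nx nz bx bz dx.1.1 (rR.trans_lt hR.1.1)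
  have k2 := H2 z' y' nz ny bz by' (rR.trans_lt hR.1.2) dy.1.2
  rw [txz.comparisonAngle_le_iff nx nz (by linarith) (by linarith), ← hu] at k1
  rw [tyz.swap.comparisonAngle_le_iff nz ny (by linarith) (by linarith), hingeMd_comm,
    ← hv] at k2
  have l1 := le_of_modelMd_le u0 (txz.rotate.side.avg (huv.mono (by linarith))) k1
  have l2 := le_of_modelMd_le v0 (tyz.swap.rotate.side.avg (huv.mono (by linarith))) k2
  have l3 : dist x' y' ≤ u + v := (dist_triangle _ _ _).trans (add_le_add l1 l2)
  rw [txy.comparisonAngle_le_iff nx ny (by linarith) hπ.le,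
    show α + β + ε = α + ε / 2 + (β + ε / 2) by ring, ← hw]
  exact modelMd_le dist_nonneg l3 (txy.rotate.side.avg huv)

/-- The angle between opposite directions of a geodesic is `π`. -/
theorem AngleLE.pi_le (hU : UniqueBetween κ X) {θ : ℝ} (hz : MetricBetween b z c) (zb : z ≠ b)
    (zc : z ≠ c) (hbc : BelowVarpi κ (dist b c)) (h : AngleLE κ z b c θ) : Real.pi ≤ θ := by
  refine le_of_forall_pos_le_add fun ε hε => ?_
  obtain ⟨ρ, hρ, H⟩ := h ε hε
  obtain ⟨ρ', hρ', h'⟩ := exists_pos_belowVarpi_two_mul κ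
  set δ := min (min (ρ / 2) (ρ' / 2)) (min (dist z b) (dist z c)) with hδ
  have hδ0 : 0 < δ := lt_min (lt_min (by positivity) (by positivity))
    (lt_min (dist_pos.2 zb) (dist_pos.2 zc))
  have hδ1 : δ ≤ ρ / 2 := (min_le_left _ _).trans (min_le_left _ _)
  have hδ2 : δ ≤ ρ' / 2 := (min_le_left _ _).trans (min_le_right _ _)
  have hδ3 : δ ≤ dist z b := (min_le_right _ _).trans (min_le_left _ _)
  have hδ4 : δ ≤ dist z c := (min_le_right _ _).trans (min_le_right _ _)
  have hzb : BelowVarpi κ (dist z b) := hbc.mono (by rw [dist_comm]; exact hz.dist_le)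
  have hzc : BelowVarpi κ (dist z c) := hbc.mono (by
    rw [dist_comm z, dist_comm b]; exact hz.symm.dist_le)
  obtain ⟨b', hb, db⟩ := hU.exists_between hzb hδ0.le hδ3
  obtain ⟨c', hc, dc⟩ := hU.exists_between hzc hδ0.le hδ4
  have nb : z ≠ b' := dist_pos.1 (db ▸ hδ0)
  have nc : z ≠ c' := dist_pos.1 (dc ▸ hδ0)
  have hbt : MetricBetween b' z c' := ((hz.trans hb.symm).2.symm.trans hc.symm).2.symm
  rw [← hbt.comparisonAngle_eq_pi (smallTriangle_of_dist_lt h' (by linarith) (by linarith)) nb nc]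
  exact H b' c' nb nc hb hc (by linarith) (by linarith)

/-- Upper angles depend only on the beginnings of the geodesics. -/
theorem AngleLE.extend (hU : UniqueBetween κ X) {θ : ℝ} (hx : MetricBetween p x q) (px : p ≠ x)
    (hpq : BelowVarpi κ (dist p q)) (h : AngleLE κ p x y θ) : AngleLE κ p q y θ := by
  intro ε hε
  obtain ⟨ρ, hρ, H⟩ := h ε hε
  refine ⟨min ρ (dist p x), lt_min hρ (dist_pos.2 px), fun x' y' h1 h2 h3 h4 h5 h6 => ?_⟩
  rw [lt_min_iff] at h5 h6
  exact H x' y' h1 h2 (hU.between_of_le hpq hx h3 h5.2.le) h4 h5.1 h6.1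

theorem AngleLE.restrict {θ : ℝ} (hx : MetricBetween p x q) (h : AngleLE κ p q y θ) :
    AngleLE κ p x y θ := by
  intro ε hε
  obtain ⟨ρ, hρ, H⟩ := h ε hε
  exact ⟨ρ, hρ, fun x' y' h1 h2 h3 h4 h5 h6 => H x' y' h1 h2 (hx.trans h3).1 h4 h5 h6⟩

theorem AngleLE.self (hU : UniqueBetween κ X) (hpx : BelowVarpi κ (dist p x)) :
    AngleLE κ p x x 0 := by
  intro ε hε
  obtain ⟨ρ, hρ, h⟩ := exists_pos_belowVarpi_two_mul κ
  refine ⟨ρ, hρ, fun x' y' h1 h2 h3 h4 h5 h6 => ?_⟩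
  have t := smallTriangle_of_dist_lt h h5 h6
  rcases le_total (dist p x') (dist p y') with hle | hle
  · rw [comparisonAngle_eq_zero t h1 (hU.between_of_le hpx h4 h3 hle)]
    linarith
  · rw [t.comparisonAngle_comm h1 h2,
      comparisonAngle_eq_zero t.swap h2 (hU.between_of_le hpx h3 h4 hle)]
    linarith

/-- If the triangle is nondegenerate at `a`, then its angle at `a` does not exceed the model
angle. -/
def AngleComparison (κ : ℝ) (a b c : X) : Prop :=
  a ≠ b → a ≠ c → AngleLE κ a b c (comparisonAngle κ a b c)

theorem AngleComparison.symm (h : AngleComparison κ a b c) (ht : SmallTriangle κ a b c) :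
    AngleComparison κ a c b := by
  intro hc hb
  rw [← ht.comparisonAngle_comm hb hc]
  exact (h hb hc).symm

theorem AngleComparison.of_between (hU : UniqueBetween κ X) (hac : BelowVarpi κ (dist a c))
    (hb : MetricBetween a b c) : AngleComparison κ a b c := fun _ _ =>
  ((AngleLE.self hU hac).restrict hb).mono (comparisonAngle_nonneg _ _ _ _)

theorem AngleComparison.of_between_vertex (hz : MetricBetween b a c)
    (ht : SmallTriangle κ a b c) : AngleComparison κ a b c := by
  intro hb hc ε hε
  refine ⟨1, one_pos, fun x' y' _ _ _ _ _ _ => ?_⟩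
  rw [hz.comparisonAngle_eq_pi ht hb hc]
  linarith [comparisonAngle_le_pi κ a x' y']

/-- All angles of the triangle do not exceed the corresponding model angles. -/
def GoodTriangle (κ : ℝ) (a b c : X) : Prop :=
  AngleComparison κ a b c ∧ AngleComparison κ b c a ∧ AngleComparison κ c a b

theorem GoodTriangle.rotate (h : GoodTriangle κ a b c) : GoodTriangle κ b c a :=
  ⟨h.2.1, h.2.2, h.1⟩

theorem GoodTriangle.swap (h : GoodTriangle κ a b c) (ht : SmallTriangle κ a b c) :
    GoodTriangle κ a c b :=
  ⟨h.1.symm ht, h.2.2.symm ht.rotate.rotate, h.2.1.symm ht.rotate⟩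

/-- At `a` the model angle is `π`, so there is nothing to bound; at `b` and `c` the two sides start
along the same geodesic and make a zero upper angle. -/
theorem GoodTriangle.of_between (hU : UniqueBetween κ X) (h : SmallTriangle κ a b c)
    (ha : MetricBetween b a c) : GoodTriangle κ a b c :=
  ⟨.of_between_vertex ha h,
    (AngleComparison.of_between hU h.rotate.side ha).symm h.rotate.swap,
    .of_between hU h.swap.rotate.side ha.symm⟩

/-- The upper angle between the opposite directions at `z` is `π`, so by the triangle inequality for
upper angles the two model angles at `z`, which dominate the upper ones, add up to at least `π`. -/
theorem sideComparison_of_angleComparison (hU : UniqueBetween κ X) (h : SmallTriangle κ a b c)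
    (hz : MetricBetween b z c) (h1 : AngleComparison κ z a b) (h2 : AngleComparison κ z a c) :
    SideComparison κ a b c z := by
  rcases eq_or_ne a z with rfl | az
  · simp [SideComparison, dist_comm, modelMd_zero]
  rcases eq_or_ne z b with rfl | zb
  · simp [SideComparison, modelMd_zero, modelSin_zero]
  rcases eq_or_ne z c with rfl | zc
  · simp [SideComparison, modelMd_zero, modelSin_zero]
  have hb := h.sub hz
  have hc := h.swap.sub hz.symm
  rw [← hb.rotate.rotate.pi_le_add_iff hc.rotate.rotate az.symm zb zc]
  exact ((h1 az.symm zb).symm.add hU az.symm hb.rotate.rotate.side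
    (comparisonAngle_nonneg _ _ _ _) (comparisonAngle_nonneg _ _ _ _) (h2 az.symm zc)).pi_le
    hU hz zb zc h.rotate.side

/-- Monotonicity of the model angle follows from the comparison for points on the sides. -/
theorem comparisonAngle_mono (h : SmallTriangle κ a b c) (hz : MetricBetween a z b)
    (az : a ≠ z) (ab : a ≠ b) (ac : a ≠ c) (hs : c ≠ b → SideComparison κ c a b z) :
    comparisonAngle κ a c z ≤ comparisonAngle κ a c b := by
  have hb : SmallTriangle κ a c z := (h.rotate.rotate.sub hz).rotate.swap
  rcases eq_or_ne c b with rfl | cb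
  · rw [hb.comparisonAngle_comm ac az, comparisonAngle_eq_zero hb.swap az hz]
    exact comparisonAngle_nonneg _ _ _ _
  · rw [hb.comparisonAngle_le_iff ac az (comparisonAngle_nonneg _ _ _ _)
      (comparisonAngle_le_pi _ _ _ _)]
    exact (h.swap.sideComparison_iff hz ac ab).1 (hs cb)

/-- The inheritance lemma: if the two pieces of a triangle cut along a segment from `a` to a
point of the opposite side are good, then so is the triangle. -/
theorem GoodTriangle.glue (hU : UniqueBetween κ X) (h : SmallTriangle κ a b c)
    (hz : MetricBetween b z c) (h1 : GoodTriangle κ a b z) (h2 : GoodTriangle κ a z c) :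
    GoodTriangle κ a b c := by
  rcases eq_or_ne z b with rfl | zb
  · exact h2
  rcases eq_or_ne z c with rfl | zc
  · exact h1
  rcases eq_or_ne a z with rfl | az
  · exact .of_between hU h hz
  rcases eq_or_ne a b with rfl | ab
  · exact .of_between hU h (.left _ _)
  rcases eq_or_ne a c with rfl | ac
  · exact .of_between hU h (.right _ _)
  have bc : b ≠ c := by
    rintro rfl
    have := hz.dist_le
    rw [dist_self, dist_comm] at this
    exact zb (dist_le_zero.1 this)
  have hb := h.sub hz
  have hc := h.swap.sub hz.symm
  have hs := sideComparison_of_angleComparison hU h hz h1.2.2 (h2.2.1.symm hc.rotate.rotate.swap)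
  -- At `a` upper angles are subadditive and model angles superadditive. At `b` and `c` the upper
  -- angle is that of a piece, and the model angle only grows from the piece to the whole, by the
  -- side comparison at `z`.
  refine ⟨fun _ _ => ?_, fun _ _ => ?_, fun _ _ => ?_⟩
  · refine ((h1.1 ab az).add hU az hb.swap.side (comparisonAngle_nonneg _ _ _ _)
      (comparisonAngle_nonneg _ _ _ _) (h2.1 az ac)).mono ?_
    rw [hc.swap.comparisonAngle_comm az ac]
    exact comparisonAngle_add_le h hz ab ac az
  · refine ((h1.2.1 zb.symm ab.symm).extend hU hz zb.symm h.rotate.side).mono ?_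
    rw [hb.rotate.comparisonAngle_comm zb.symm ab.symm, h.rotate.comparisonAngle_comm bc ab.symm]
    exact comparisonAngle_mono h.rotate hz zb.symm bc ab.symm fun _ => hs
  · refine ((h2.2.2 ac.symm zc.symm).symm.extend hU hz.symm zc.symm
      h.swap.rotate.side).symm.mono ?_
    exact comparisonAngle_mono h.swap.rotate hz.symm zc.symm bc.symm ac.symm fun _ => hs.symm

/-- Triangles in a small ball of a locally `CAT(κ)` space are good. -/
theorem exists_ball_goodTriangle (hX : IsLocallyCAT κ X) (q : X) :
    ∃ ρ > 0, ∀ a ∈ Metric.ball q ρ, ∀ b ∈ Metric.ball q ρ, ∀ c ∈ Metric.ball q ρ,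
      SmallTriangle κ a b c → GoodTriangle κ a b c := by
  obtain ⟨Ω, hΩ, hC⟩ := hX q
  obtain ⟨ε, hε, hball⟩ := Metric.mem_nhds_iff.1 hΩ
  have key : ∀ a ∈ Metric.ball q (ε / 3), ∀ b ∈ Metric.ball q (ε / 3),
      ∀ c ∈ Metric.ball q (ε / 3), SmallTriangle κ a b c → AngleComparison κ a b c := by
    intro a ha b hb c hc ht ab ac ε' hε'
    refine ⟨1, one_pos, fun x' y' ax ay hx hy _ _ => le_trans ?_ (le_add_of_nonneg_right hε'.le)⟩
    -- The radius `ε / 3` keeps the sides inside `Ω`: for `x` between `a` and `y`, `|xq| ≤ |ay| +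
    -- |aq| ≤ 2 |aq| + |yq| < ε`.
    have mem : ∀ {x y}, y ∈ Metric.ball q (ε / 3) → MetricBetween a x y → x ∈ Ω := by
      intro x y hy hx
      apply hball
      rw [Metric.mem_ball] at *
      have := hx.dist_le
      rw [dist_comm a x] at this
      linarith [dist_triangle x a q, dist_triangle_right a y q]
    have ha' := mem ha (.left _ _)
    have hb' := mem hb (.right _ _)
    have hc' := mem hc (.right _ _)
    have hx' := mem hb hx
    have hy' := mem hc hy
    have t1 : SmallTriangle κ c a x' := ht.rotate.rotate.sub hx
    have t2 : SmallTriangle κ a c x' := t1.swap.rotate.rotate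
    -- The ends of the hinge are moved one at a time, `b` to `x'` and `c` to `y'`; neither move
    -- increases the model angle.
    have k1 : comparisonAngle κ a c x' ≤ comparisonAngle κ a c b :=
      comparisonAngle_mono ht hx ax ab ac fun cb =>
        sideComparison_of_CATComparison ht.rotate.rotate hx ac.symm cb
          (hC _ hx' _ hc' _ ha' _ hb')
    have k2 : comparisonAngle κ a x' y' ≤ comparisonAngle κ a x' c :=
      comparisonAngle_mono t2 hy ay ac ax fun xc =>
        sideComparison_of_CATComparison t2.rotate.rotate hy ax.symm xc
          (hC _ hy' _ hx' _ ha' _ hc')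
    rw [t2.swap.comparisonAngle_comm ax ac] at k2
    rw [ht.swap.comparisonAngle_comm ac ab] at k1
    exact k2.trans k1
  refine ⟨ε / 3, by positivity, fun a ha b hb c hc ht => ⟨key a ha b hb c hc ht,
    key b hb c hc a ha ht.rotate, key c hc a ha b hb ht.rotate.rotate⟩⟩

end Angles

/-! ### From local to global comparison. -/

section Globalization

variable {X : Type*} [MetricSpace X] {κ : ℝ} {a b c p q x y z : X}

theorem IsGeodesicPath.exists_unitSpeed {γ : unitInterval → X} (h : IsGeodesicPath γ x y) :
    ∃ e : ℝ → X, e 0 = x ∧ e (dist x y) = y ∧ ∀ u ∈ Set.Icc 0 (dist x y),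
      ∀ v ∈ Set.Icc 0 (dist x y), dist (e u) (e v) = |u - v| := by
  rcases (dist_nonneg (x := x) (y := y)).eq_or_lt with h0 | h0
  · refine ⟨fun _ => x, rfl, dist_eq_zero.1 h0.symm, fun u hu v hv => ?_⟩
    rw [← h0, Set.Icc_self] at hu hv
    rw [Set.mem_singleton_iff.1 hu, Set.mem_singleton_iff.1 hv]
    simp
  · refine ⟨fun u => γ (Set.projIcc 0 1 zero_le_one (u / dist x y)), ?_, ?_,
      fun u hu v hv => ?_⟩
    · simp only [zero_div, Set.projIcc_left]
      exact h.1
    · simp only [div_self h0.ne', Set.projIcc_right]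
      exact h.2.1
    · have mem : ∀ u ∈ Set.Icc 0 (dist x y), u / dist x y ∈ Set.Icc (0 : ℝ) 1 := fun u hu =>
        ⟨div_nonneg hu.1 h0.le, (div_le_one h0).2 hu.2⟩
      simp only [Set.projIcc_of_mem _ (mem u hu), Set.projIcc_of_mem _ (mem v hv)]
      rw [h.2.2]
      simp only [← sub_div, abs_div, abs_of_pos h0]
      exact div_mul_cancel₀ _ h0.ne'

/-- A point between `b` and `c` lies on a geodesic, the concatenation of two geodesics. -/
theorem MetricBetween.exists_geodesicPath {γ₁ γ₂ : unitInterval → X}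
    (hz : MetricBetween b z c) (h₁ : IsGeodesicPath γ₁ b z) (h₂ : IsGeodesicPath γ₂ z c)
    {t : unitInterval} (ht : t * dist b c = dist b z) :
    ∃ γ, IsGeodesicPath γ b c ∧ γ t = z := by
  obtain ⟨e₁, e10, e11, he₁⟩ := h₁.exists_unitSpeed
  obtain ⟨e₂, e20, e21, he₂⟩ := h₂.exists_unitSpeed
  unfold MetricBetween at hz
  let f : ℝ → X := fun u => if u ≤ dist b z then e₁ u else e₂ (u - dist b z)
  have f0 : f 0 = b := by simp only [f, if_pos dist_nonneg, e10]
  have fz : f (dist b z) = z := by simp only [f, if_pos le_rfl, e11]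
  have f1 : f (dist b c) = c := by
    simp only [f]
    split_ifs with hle
    · have e : dist z c = 0 := by linarith [dist_nonneg (x := z) (y := c)]
      rw [e, add_zero] at hz
      rw [← hz, e11, dist_eq_zero.1 e]
    · rw [← hz, add_sub_cancel_left, e21]
  have le : ∀ u v, 0 ≤ u → u ≤ v → v ≤ dist b c → dist (f u) (f v) ≤ v - u := by
    intro u v hu huv hv
    simp only [f]
    split_ifs with c1 c2 c2
    · rw [he₁ u ⟨hu, c1⟩ v ⟨hu.trans huv, c2⟩, abs_sub_comm, abs_of_nonneg (by linarith)]
    · have d1 := he₁ u ⟨hu, c1⟩ _ ⟨dist_nonneg, le_rfl⟩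
      have d2 := he₂ 0 ⟨le_rfl, dist_nonneg⟩ (v - dist b z) ⟨by linarith, by linarith⟩
      rw [e11, abs_sub_comm, abs_of_nonneg (by linarith)] at d1
      rw [e20, abs_sub_comm, abs_of_nonneg (by linarith)] at d2
      linarith [dist_triangle (e₁ u) z (e₂ (v - dist b z))]
    · exact absurd (huv.trans c2) c1
    · rw [he₂ _ ⟨by linarith, by linarith⟩ _ ⟨by linarith, by linarith⟩, abs_sub_comm,
        abs_of_nonneg (by linarith)]
      linarith
  -- A 1-Lipschitz curve whose ends are as far apart as its parameter interval is long must preserve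
  -- all distances.
  have eq : ∀ u v, 0 ≤ u → u ≤ v → v ≤ dist b c → dist (f u) (f v) = v - u := by
    intro u v hu huv hv
    apply le_antisymm (le u v hu huv hv)
    have k1 := le 0 u le_rfl hu (huv.trans hv)
    have k2 := le v _ (hu.trans huv) hv le_rfl
    rw [f0] at k1
    rw [f1] at k2
    linarith [dist_triangle4 b (f u) (f v) c]
  refine ⟨fun s => f (s * dist b c), ⟨by simpa using f0, by simpa using f1, ?_⟩, by
    simp only [ht, fz]⟩
  have key : ∀ r s : unitInterval, r ≤ s →
      dist (f (r * dist b c)) (f (s * dist b c)) = (s - r) * dist b c := by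
    intro r s hrs
    have hrs' : (r : ℝ) ≤ s := hrs
    rw [eq _ _ (mul_nonneg r.2.1 dist_nonneg) (mul_le_mul_of_nonneg_right hrs' dist_nonneg)
      (mul_le_of_le_one_left dist_nonneg s.2.2)]
    ring
  intro r s
  rcases le_total r s with hrs | hrs
  · rw [key r s hrs, abs_sub_comm, abs_of_nonneg (sub_nonneg.2 (Subtype.coe_le_coe.2 hrs))]
  · rw [dist_comm, key s r hrs, abs_of_nonneg (sub_nonneg.2 (Subtype.coe_le_coe.2 hrs))]

theorem IsGeodesicPath.between {γ : unitInterval → X} (h : IsGeodesicPath γ x y)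
    {s t : unitInterval} (hst : s ≤ t) : MetricBetween x (γ s) (γ t) := by
  have hst' : (s : ℝ) ≤ t := hst
  unfold MetricBetween
  rw [dist_comm x (γ s), dist_comm x (γ t), h.dist_left, h.dist_left, h.2.2, abs_sub_comm,
    abs_of_nonneg (by linarith)]
  ring

/-- Each point between `b` and `c` lies on some geodesic path from `b` to `c`, built by
concatenation. Uniqueness of that path makes the distance from `b` determine the point. -/
theorem UniquelyGeodesicBelow.uniqueBetween (h : UniquelyGeodesicBelow (varpi κ) X) :
    UniqueBetween κ X where
  exists_between := by
    intro b c hbc r hr hr'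
    obtain ⟨γ, hγ, -⟩ := h b c (edist_lt_varpi.2 hbc)
    rcases (dist_nonneg (x := b) (y := c)).eq_or_lt with h0 | h0
    · exact ⟨b, .left _ _, by rw [dist_self]; linarith⟩
    · let t : unitInterval := ⟨r / dist b c, div_nonneg hr h0.le, (div_le_one h0).2 hr'⟩
      refine ⟨γ t, ?_, ?_⟩
      · have := hγ.between (show t ≤ 1 from t.2.2)
        rwa [hγ.2.1] at this
      · rw [dist_comm, hγ.dist_left]
        exact div_mul_cancel₀ _ h0.ne'
  unique := by
    intro b c z z' hbc hz hz' he
    rcases (dist_nonneg (x := b) (y := c)).eq_or_lt with h0 | h0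
    · have h1 := hz.dist_le
      have h2 := hz'.dist_le
      rw [← h0] at h1 h2
      exact (dist_le_zero.1 h1).symm.trans (dist_le_zero.1 h2)
    · let t : unitInterval := ⟨dist b z / dist b c, div_nonneg dist_nonneg h0.le,
        (div_le_one h0).2 hz.dist_le⟩
      have ht : t * dist b c = dist b z := div_mul_cancel₀ _ h0.ne'
      have geo : ∀ {z}, MetricBetween b z c → t * dist b c = dist b z →
          ∃ γ, IsGeodesicPath γ b c ∧ γ t = z := by
        intro z hz ht
        obtain ⟨γ₁, h₁, -⟩ := h b z (edist_lt_varpi.2 (hbc.mono hz.dist_le))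
        obtain ⟨γ₂, h₂, -⟩ := h z c (edist_lt_varpi.2 (hbc.mono (by
          rw [dist_comm z, dist_comm b]; exact hz.symm.dist_le)))
        exact hz.exists_geodesicPath h₁ h₂ ht
      obtain ⟨γ, hγ, e⟩ := geo hz ht
      obtain ⟨γ', hγ', e'⟩ := geo hz' (ht.trans he)
      rw [← e, ← e', (h b c (edist_lt_varpi.2 hbc)).unique hγ hγ']

theorem SmallTriangle.sub_left (h : SmallTriangle κ a b c) (hz : MetricBetween a z b) :
    SmallTriangle κ a z c := (h.rotate.rotate.sub hz).rotate

theorem SmallTriangle.sub_right (h : SmallTriangle κ a b c) (hz : MetricBetween b z c) :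
    SmallTriangle κ a z c := (h.swap.sub hz.symm).swap

/-- A narrow triangle is good if it is cut into good small pieces by points on its long sides. -/
theorem goodTriangle_of_ladder (hU : UniqueBetween κ X) {A B : ℕ → X} (hA0 : A 0 = p)
    (hB0 : B 0 = p) (hA : ∀ j, MetricBetween p (A j) (A (j + 1)))
    (hB : ∀ j, MetricBetween p (B j) (B (j + 1)))
    (hsmall : ∀ i j, SmallTriangle κ p (A i) (B j))
    (h1 : ∀ j, SmallTriangle κ (A j) (B j) (B (j + 1)) → GoodTriangle κ (A j) (B j) (B (j + 1)))
    (h2 : ∀ j, SmallTriangle κ (B (j + 1)) (A j) (A (j + 1)) →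
      GoodTriangle κ (B (j + 1)) (A j) (A (j + 1))) (j : ℕ) : GoodTriangle κ p (A j) (B j) := by
  induction j with
  | zero =>
    have := hsmall 0 0
    rw [hA0, hB0] at *
    exact .of_between hU this (.left _ _)
  | succ j ih =>
    have s1 : SmallTriangle κ (A j) p (B (j + 1)) := (hsmall j (j + 1)).swap.rotate.rotate
    have s2 : SmallTriangle κ (B (j + 1)) p (A (j + 1)) := (hsmall (j + 1) (j + 1)).rotate.rotate
    -- Each rung is crossed in two gluings, along `A j`, `B j` and along the diagonal `A j`, `B (j +
    -- 1)` of the cell.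
    have g1 := GoodTriangle.glue hU s1 (hB j) (ih.swap (hsmall j j)).rotate.rotate
      (h1 j (s1.sub_right (hB j)))
    have g2 := GoodTriangle.glue hU s2 (hA j) (g1.rotate.rotate.swap s1.rotate.rotate)
      (h2 j (s2.sub_right (hA j)))
    exact g2.rotate

/-- Alexandrov's patchwork: local comparison and continuity of geodesics imply that all triangles
are good. -/
theorem goodTriangle_of_isLocallyCAT (hX : IsLocallyCAT κ X) (hU : UniqueBetween κ X)
    (hG : GeodesicsContinuousBelow (varpi κ) X) (h : SmallTriangle κ p x y) :
    GoodTriangle κ p x y := by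
  obtain ⟨Γ, hΓ, hΓc⟩ := hG
  choose ρ hρ hgood using exists_ball_goodTriangle hX
  have hxy : edist x y < varpi κ := edist_lt_varpi.2 h.rotate.side
  let σ := Γ ⟨(x, y), hxy⟩
  have hσ : IsGeodesicPath σ x y := hΓ _
  have hσy : ∀ t, MetricBetween x (σ t) y := fun t => by
    have := hσ.between (show t ≤ 1 from t.2.2)
    rwa [hσ.2.1] at this
  have hd : ∀ t, edist p (σ t) < varpi κ := fun t =>
    edist_lt_varpi.2 (h.sub (hσy t)).swap.side
  -- `H` sweeps the triangle by the geodesics from `p` to the points of the side `xy`. By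
  -- compactness of the square, a fine grid has each cell mapped into a ball of good triangles.
  let H : unitInterval × unitInterval → X := fun u => Γ ⟨(p, σ u.1), hd u.1⟩ u.2
  have hH : Continuous H := by
    have : Continuous fun u : unitInterval × unitInterval => Γ ⟨(p, σ u.1), hd u.1⟩ :=
      hΓc.comp (Continuous.subtype_mk (by fun_prop) _)
    exact this.eval continuous_snd
  have hHg : ∀ s, IsGeodesicPath (fun t => H (s, t)) p (σ s) := fun s => hΓ _
  obtain ⟨t, t0, tm, ⟨n, hn⟩, hcell⟩ :=
    exists_monotone_Icc_subset_open_cover_unitInterval_prod_self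
      (c := fun q : X => H ⁻¹' Metric.ball q (ρ q)) (fun q => Metric.isOpen_ball.preimage hH)
      (fun u _ => Set.mem_iUnion.2 ⟨H u, Metric.mem_ball_self (hρ _)⟩)
  have small : ∀ {s s'}, s ≤ s' → SmallTriangle κ p (σ s) (σ s') := fun {s s'} hs =>
    (h.sub (hσy s')).sub_right (hσ.between hs)
  have narrow : ∀ i, GoodTriangle κ p (σ (t i)) (σ (t (i + 1))) := by
    intro i
    have ti := tm (Nat.le_succ i)
    have hend : ∀ s r, MetricBetween p (H (s, r)) (σ s) := fun s r => by
      have := (hHg s).between (show r ≤ 1 from r.2.2)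
      rwa [show H (s, 1) = σ s from (hHg s).2.1] at this
    have key := goodTriangle_of_ladder hU (p := p) (A := fun j => H (t i, t j))
      (B := fun j => H (t (i + 1), t j)) (by rw [t0]; exact (hHg _).1)
      (by rw [t0]; exact (hHg _).1) (fun j => (hHg _).between (tm (Nat.le_succ j)))
      (fun j => (hHg _).between (tm (Nat.le_succ j)))
      (fun j k => (((small ti).sub_left (hend _ _)).swap.sub_left (hend _ _)).swap) ?_ ?_ n
    · rw [hn n le_rfl] at key
      have e : ∀ s, H (s, 1) = σ s := fun s => (hHg s).2.1
      simpa only [e] using key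
    all_goals
      intro j hs
      obtain ⟨q, hq⟩ := hcell i j
      have tj := tm (Nat.le_succ j)
      have c00 : H (t i, t j) ∈ Metric.ball q (ρ q) := hq ⟨⟨le_rfl, ti⟩, ⟨le_rfl, tj⟩⟩
      have c01 : H (t i, t (j + 1)) ∈ Metric.ball q (ρ q) := hq ⟨⟨le_rfl, ti⟩, ⟨tj, le_rfl⟩⟩
      have c10 : H (t (i + 1), t j) ∈ Metric.ball q (ρ q) := hq ⟨⟨ti, le_rfl⟩, ⟨le_rfl, tj⟩⟩
      have c11 : H (t (i + 1), t (j + 1)) ∈ Metric.ball q (ρ q) :=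
        hq ⟨⟨ti, le_rfl⟩, ⟨tj, le_rfl⟩⟩
      first
        | exact hgood q _ c00 _ c10 _ c11 hs
        | exact hgood q _ c11 _ c00 _ c01 hs
  -- The narrow triangles are glued one after another along the geodesics issuing from `p`.
  have fan : ∀ i, GoodTriangle κ p x (σ (t i)) := by
    intro i
    induction i with
    | zero =>
      rw [t0, hσ.1]
      have hs : SmallTriangle κ p x x := h.sub (.left _ _)
      exact (GoodTriangle.of_between hU hs.rotate (.left _ _)).rotate.rotate
    | succ i ih =>
      exact .glue hU (h.sub (hσy _)) (hσ.between (tm (Nat.le_succ i))) ih (narrow i)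
  have := fan n
  rwa [hn n le_rfl, hσ.2.1] at this

/-! ### Back to four points. -/

section FourPoint

variable {p₁ p₂ x₁ x₂ : X}

/-- The degenerate case that `exists_crossing` leaves out. A zero angle at `p₁` puts `x₁` between
`p₁` and `p₂`, where model angles are monotone, or `p₂` between `p₁` and `x₁`, where the angle at
`p₂` would be `π`. -/
theorem comparisonAngle_le_of_eq_zero (hS : ∀ a b c z : X, SmallTriangle κ a b c →
      MetricBetween b z c → SideComparison κ a b c z)
    (t : SmallTriangle κ p₁ x₁ x₂) (t1 : SmallTriangle κ p₁ p₂ x₁)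
    (t2 : SmallTriangle κ p₁ p₂ x₂) (pp : p₁ ≠ p₂) (px₁ : p₁ ≠ x₁) (px₂ : p₁ ≠ x₂)
    (px₁' : p₂ ≠ x₁) (hπ : comparisonAngle κ p₂ p₁ x₁ < Real.pi)
    (h0 : comparisonAngle κ p₁ p₂ x₁ = 0) :
    comparisonAngle κ p₁ x₁ x₂ ≤ comparisonAngle κ p₁ p₂ x₂ := by
  have e := t1.eq_hingeMd pp px₁
  rw [h0, hingeMd_zero] at e
  have h1 : modelMd κ (dist p₂ x₁) = modelMd κ |dist p₁ p₂ - dist p₁ x₁| := by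
    rw [e]
    rcases abs_choice (dist p₁ p₂ - dist p₁ x₁) with h | h <;> rw [h]
    rw [modelMd_neg]
  have e2 := eq_of_modelMd_eq dist_nonneg (abs_nonneg _) (t1.rotate.side.avg
    (t1.rotate.side.mono (abs_sub_le_iff.2
      ⟨by linarith [dist_triangle p₁ x₁ p₂, dist_comm x₁ p₂], by
        linarith [dist_triangle p₁ p₂ x₁]⟩))) h1
  rcases le_total (dist p₁ x₁) (dist p₁ p₂) with hle | hle
  · rw [abs_of_nonneg (sub_nonneg.2 hle), dist_comm p₂] at e2
    have hb : MetricBetween p₁ x₁ p₂ := by unfold MetricBetween; linarith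
    rw [t.comparisonAngle_comm px₁ px₂, t2.comparisonAngle_comm pp px₂]
    exact comparisonAngle_mono t2 hb px₁ pp px₂ fun _ => hS _ _ _ _ t2.rotate.rotate hb
  · rw [abs_of_nonpos (sub_nonpos.2 hle)] at e2
    have hb : MetricBetween p₁ p₂ x₁ := by unfold MetricBetween; linarith
    rw [hb.comparisonAngle_eq_pi t1.swap.rotate.rotate pp.symm px₁'] at hπ
    exact absurd hπ (lt_irrefl _)

/-- The laws of cosines and of sines: the two components of the tangent vector at `p₂` towards `x₁`,
computed from the hinge at `p₁`, are expressed by the model angle at `p₂`. -/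
theorem hingeRadial_eq (t : SmallTriangle κ p₁ p₂ x₁) (pp : p₁ ≠ p₂) (px : p₁ ≠ x₁)
    (px' : p₂ ≠ x₁) :
    hingeRadial κ (dist p₁ x₁) (dist p₁ p₂) (comparisonAngle κ p₁ p₂ x₁)
        = modelSin κ (dist p₂ x₁) * Real.cos (comparisonAngle κ p₂ p₁ x₁) ∧
      modelSin κ (dist p₁ x₁) * Real.sin (comparisonAngle κ p₁ p₂ x₁)
        = modelSin κ (dist p₂ x₁) * Real.sin (comparisonAngle κ p₂ p₁ x₁) := by
  have e1 := t.eq_hingeMd pp px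
  have e2 := t.swap.rotate.rotate.eq_hingeMd pp.symm px'
  have sR := t.modelSin_pos pp
  have sb := t.swap.modelSin_pos px
  have sb' := t.rotate.modelSin_pos px'
  rw [hingeMd_comm] at e1
  have k := modelSin_mul_hingeRadial κ (dist p₁ x₁) (dist p₁ p₂) (comparisonAngle κ p₁ p₂ x₁)
  have k2 := hingeRadial_sq_add_eq e1
  have f1 : hingeRadial κ (dist p₁ x₁) (dist p₁ p₂) (comparisonAngle κ p₁ p₂ x₁)
        = modelSin κ (dist p₂ x₁) * Real.cos (comparisonAngle κ p₂ p₁ x₁) := by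
    apply mul_left_cancel₀ sR.ne'
    rw [k, ← e1, e2, hingeMd, dist_comm p₂ p₁]
    ring
  refine ⟨f1, ?_⟩
  have n1 : 0 ≤ Real.sin (comparisonAngle κ p₁ p₂ x₁) := Real.sin_nonneg_of_nonneg_of_le_pi
    (comparisonAngle_nonneg _ _ _ _) (comparisonAngle_le_pi _ _ _ _)
  have n2 : 0 ≤ Real.sin (comparisonAngle κ p₂ p₁ x₁) := Real.sin_nonneg_of_nonneg_of_le_pi
    (comparisonAngle_nonneg _ _ _ _) (comparisonAngle_le_pi _ _ _ _)
  rw [← sq_eq_sq₀ (by positivity) (by positivity)]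
  rw [f1] at k2
  linear_combination k2 - modelSin κ (dist p₂ x₁) ^ 2 *
    Real.sin_sq_add_cos_sq (comparisonAngle κ p₂ p₁ x₁)

/-- The comparison for points on the sides of triangles implies the four-point comparison. -/
theorem CATComparison_of_sideComparison (hU : UniqueBetween κ X)
    (hS : ∀ a b c z : X, SmallTriangle κ a b c → MetricBetween b z c →
      SideComparison κ a b c z) (p₁ p₂ x₁ x₂ : X) : CATComparison κ p₁ p₂ x₁ x₂ := by
  by_cases hdef : ComparisonAngleDefined κ p₁ x₁ x₂ ∧ ComparisonAngleDefined κ p₁ p₂ x₁ ∧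
    ComparisonAngleDefined κ p₁ p₂ x₂ ∧ ComparisonAngleDefined κ p₂ x₁ x₂ ∧
    ComparisonAngleDefined κ p₂ p₁ x₁ ∧ ComparisonAngleDefined κ p₂ p₁ x₂
  swap
  · exact Or.inr (Or.inr hdef)
  simp only [comparisonAngleDefined_iff] at hdef
  obtain ⟨⟨px₁, px₂, t⟩, ⟨pp, -, t1⟩, ⟨-, -, t2⟩, ⟨px₁', px₂', -⟩, -, -⟩ := hdef
  by_cases h2 : Real.pi ≤ comparisonAngle κ p₂ p₁ x₁ + comparisonAngle κ p₂ p₁ x₂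
  · exact Or.inr (Or.inl ((comparisonAngle_le_pi _ _ _ _).trans h2))
  left
  by_cases h1 : Real.pi ≤ comparisonAngle κ p₁ p₂ x₁ + comparisonAngle κ p₁ p₂ x₂
  · exact (comparisonAngle_le_pi _ _ _ _).trans h1
  push Not at h1 h2
  have nα' := comparisonAngle_nonneg κ p₂ p₁ x₁
  have nβ' := comparisonAngle_nonneg κ p₂ p₁ x₂
  rcases (comparisonAngle_nonneg κ p₁ p₂ x₁).eq_or_lt with hα | hα
  · rw [← hα, zero_add]
    exact comparisonAngle_le_of_eq_zero hS t t1 t2 pp px₁ px₂ px₁' (by linarith) hα.symm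
  rcases (comparisonAngle_nonneg κ p₁ p₂ x₂).eq_or_lt with hβ | hβ
  · rw [← hβ, add_zero, t.comparisonAngle_comm px₁ px₂]
    exact comparisonAngle_le_of_eq_zero hS t.swap t2 t1 pp px₂ px₁ px₂' (by linarith) hβ.symm
  obtain ⟨f1, f2⟩ := hingeRadial_eq t1 pp px₁ px₁'
  obtain ⟨g1, g2⟩ := hingeRadial_eq t2 pp px₂ px₂'
  -- In terms of the angles at `p₂` this is a positive multiple of the sine of their sum, which is
  -- less than `π`: the model quadrilateral is convex at `p₂`, so the segment `x₁x₂` meets the side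
  -- `p₁p₂`.
  have hD : 0 ≤ hingeRadial κ (dist p₁ x₁) (dist p₁ p₂) (comparisonAngle κ p₁ p₂ x₁)
      * (modelSin κ (dist p₁ x₂) * Real.sin (comparisonAngle κ p₁ p₂ x₂))
      + modelSin κ (dist p₁ x₁) * Real.sin (comparisonAngle κ p₁ p₂ x₁)
      * hingeRadial κ (dist p₁ x₂) (dist p₁ p₂) (comparisonAngle κ p₁ p₂ x₂) := by
    have s1 := t1.rotate.modelSin_pos px₁'
    have s2 := t2.rotate.modelSin_pos px₂'
    have s12 := Real.sin_nonneg_of_nonneg_of_le_pi (add_nonneg nα' nβ') h2.le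
    have := mul_nonneg (mul_pos s1 s2).le s12
    rw [Real.sin_add] at this
    rw [f1, f2, g1, g2]
    linarith
  obtain ⟨r, u, v, r0, rR, u0, v0, huv, hu, hv, hw⟩ := exists_crossing (dist_pos.2 px₁)
    (dist_pos.2 px₂) dist_nonneg t.side t.swap.side t1.side hα hβ h1 hD
  obtain ⟨z, hz, rfl⟩ := hU.exists_between t1.side r0.le rR
  have pz : p₁ ≠ z := dist_pos.1 r0
  -- By monotonicity of the angle at `p₁`, the crossing point `z` in the space is no farther from
  -- `x₁` and `x₂` than its model counterpart.
  have key : ∀ {x w}, SmallTriangle κ p₁ p₂ x → p₁ ≠ x → 0 ≤ w → BelowVarpi κ w →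
      modelMd κ w = hingeMd κ (dist p₁ x) (dist p₁ z) (comparisonAngle κ p₁ p₂ x) →
      dist x z ≤ w := by
    intro x w tx px w0 hw he
    have tz : SmallTriangle κ p₁ x z := (tx.sub_left hz).swap
    have hm := comparisonAngle_mono tx hz pz pp px fun _ => hS _ _ _ _ tx.rotate.rotate hz
    rw [← tx.comparisonAngle_comm pp px, tz.comparisonAngle_le_iff px pz
      (comparisonAngle_nonneg _ _ _ _) (comparisonAngle_le_pi _ _ _ _), ← he] at hm
    exact le_of_modelMd_le w0 (tz.rotate.side.avg hw) hm
  have l1 := key t1 px₁ u0 (huv.mono (by linarith)) hu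
  have l2 := key t2 px₂ v0 (huv.mono (by linarith)) hv
  rw [t.comparisonAngle_le_iff px₁ px₂ (by linarith) h1.le, ← hw]
  exact modelMd_le dist_nonneg ((dist_triangle_right _ _ z).trans (add_le_add l1 l2))
    (t.rotate.side.avg huv)

end FourPoint

/-- A point `z` of the side `bc` cuts `abc` into two good triangles, and only their angles at `z`
enter the side comparison. -/
theorem isCAT_of_isLocallyCAT (hX : IsLocallyCAT κ X)
    (hu : UniquelyGeodesicBelow (varpi κ) X) (hG : GeodesicsContinuousBelow (varpi κ) X) :
    IsCAT κ X := by
  have hU := hu.uniqueBetween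
  refine CATComparison_of_sideComparison hU fun a b c z h hz => ?_
  have hb := h.sub hz
  have hc := h.sub_right hz
  exact sideComparison_of_angleComparison hU h hz (goodTriangle_of_isLocallyCAT hX hU hG hb).2.2
    ((goodTriangle_of_isLocallyCAT hX hU hG hc).2.1.symm hc.rotate)

end Globalization

theorem mainTheorem3 (κ : ℝ) {U : Type*} [MetricSpace U] [CompleteSpace U]
    (hU : IsLengthSpace U) :
    IsCAT κ U ↔
      IsLocallyCAT κ U ∧
        UniquelyGeodesicBelow (varpi κ) U ∧ GeodesicsContinuousBelow (varpi κ) U :=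
  ⟨fun h => ⟨fun _ => ⟨Set.univ, Filter.univ_mem, fun p₁ _ p₂ _ x₁ _ x₂ _ => h p₁ p₂ x₁ x₂⟩,
    h.uniquelyGeodesicBelow hU, h.geodesicsContinuousBelow hU⟩,
    fun ⟨h1, h2, h3⟩ => isCAT_of_isLocallyCAT h1 h2 h3⟩
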